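/- Let $\Omega\subset\mathbb{R}^{n+1}$ be a compact convex set with $0$ in its interior and with $C^1$ boundary, let $\mathcal N_\Omega(X)$ be the outward unit normal at $X\in\partial\Omega$, let $\omega_\Omega(r)=\sup\{|\mathcal N_\Omega(X_1)-\mathcal N_\Omega(X_2)| : X_1,X_2\in\partial\Omega,\ |X_1-X_2|<r\}$, and let $c(X,\bar X)=\tfrac12|X-\bar X|^2$. For $X\in\partial\Omega$ let $T_X=\mathcal N_\Omega(X)^\perp$ and let $[Y]_X\in T_X$ denote the orthogonal projection of $Y-X$ onto $T_X$; for a set $A$, $[A]_X=\{[Y]_X : Y\in A\}$. For $A\subset T_X$ and a unit vector $w\in T_X$, let $\Pi^w_A\subset T_X$ be the hyperplane supporting $A$ at a point at which $w$ is an outward normal vector, and let $$l(A,w)=\sup\{|y_1-y_2| : y_1,y_2\in A,\ y_1-y_2=|y_1-y_2|\,w\}.$$ A function $u:B_R(0)\to\mathbb{R}$ is called $c$-convex if there is a function $v:B_R(0)\to\mathbb{R}\cup\{\infty\}$ with $u(X)=\sup_{Y\in B_R(0)}(-c(X,Y)-v(Y))$ for all $X\in B_R(0)$. For $X\in\partial\Omega$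 let $$\partial^\Omega_c u(X)=\{\bar X\in\partial\Omega : u(Y)\ge -c(Y,\bar X)+c(X,\bar X)+u(X)\ \text{ for all } Y\in\partial\Omega\},$$ and for $A\subset\partial\Omega$ let $\partial_c^\Omega u(A)=\bigcup_{X\in A}\partial_c^\Omega u(X)$. **Theorem (localized upper Aleksandrov estimate).** There is a constant $C>0$, depending only on $\Omega$, with the following property. Let $R>0$ be such that $\Omega\subset B_R(0)$, let $r>0$ satisfy $\omega_\Omega(r)<\sqrt{2-2\cdot\tfrac{35}{36}}$, and let $u:B_R(0)\to\mathbb{R}$ be $c$-convex with $\partial_c^\Omega u(X)\neq\emptyset$ for every $X\in\partial\Omega$. Let $\bar X_0\in\partial\Omega$ and $h>0$, and put $m_0(X)=-c(X,\bar X_0)+h$ and $S=\{X\in\partial\Omega : u(X)\le m_0(X)\}$. Assume that $$\partial_c^\Omega u(X)\subset B_{r/8}(X)\ \text{ for all } X\in\partial\Omega,\qquad S\subset B_{r/8}(\bar X_0).$$ Then for every unit vector $w\in T_{\bar X_0}$ and every $X_0\in S$ with $m_0(X_0)>u(X_0)$, the distance from $[X_0]_{\bar X_0}$ to $\Pi^w_{[S]_{\bar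 X_0}}$ is positive and $$C\,\mathcal H^n\big(\partial^\Omega_c u(S)\big)\,\mathcal H^n(S)\ \ge\ \frac{l\big([S]_{\bar X_0},w\big)}{d\big([X_0]_{\bar X_0},\Pi^w_{[S]_{\bar X_0}}\big)}\,\big(m_0(X_0)-u(X_0)\big)^n,$$ where $\mathcal H^n$ is the $n$-dimensional Hausdorff measure. -/

import Mathlib

open MeasureTheory Set
open scoped InnerProductSpace MeasureTheory

namespace BoundaryTransport

noncomputable section

section Definitions

variable {F : Type*} [NormedAddCommGroup F] [InnerProductSpace ℝ F]

/-- The quadratic cost `c(X, Y) = |X - Y|² / 2` of the ambient space. -/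
def cost (X Y : F) : ℝ := ‖X - Y‖ ^ 2 / 2

/-- The set of outward unit normal vectors to `Ω` at `X`. -/
def outwardNormals (Ω : Set F) (X : F) : Set F :=
  {V | ‖V‖ = 1 ∧ ∀ Y ∈ Ω, ⟪V, Y - X⟫_ℝ ≤ 0}

/-- `Ω` has `C¹` boundary: near each boundary point, `Ω` is the sublevel set `{φ ≤ 0}` of a `C¹`
function `φ` whose differential does not vanish at that point. -/
def HasC1Boundary (Ω : Set F) : Prop :=
  ∀ X ∈ frontier Ω, ∃ (U : Set F) (φ : F → ℝ), IsOpen U ∧ X ∈ U ∧ ContDiffOn ℝ 1 φ U ∧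
    fderiv ℝ φ X ≠ 0 ∧ Ω ∩ U = {Y ∈ U | φ Y ≤ 0}

/-- The outward unit normal to `Ω` at `X`; for a convex body with `C¹` boundary and `X` in the
boundary, `outwardNormals Ω X` has exactly one element, and this is it. -/
def unitNormal (Ω : Set F) (X : F) : F :=
  Classical.epsilon fun V => V ∈ outwardNormals Ω X

/-- The modulus of continuity of the unit normal:
`ω(r) = sup {|N(X₁) - N(X₂)| : X₁, X₂ ∈ ∂Ω, |X₁ - X₂| < r}` (a set of reals bounded by `2`). -/
def normalModulus (Ω : Set F) (r : ℝ) : ℝ :=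
  sSup {s : ℝ | ∃ X₁ ∈ frontier Ω, ∃ X₂ ∈ frontier Ω,
    ‖X₁ - X₂‖ < r ∧ s = ‖unitNormal Ω X₁ - unitNormal Ω X₂‖}

/-- `r` is an admissible value of the radius `r(Θ)`: it is positive and `ω(r) < √(2 - 2 Θ)`. -/
def IsAdmissibleRadius (Ω : Set F) (Θ r : ℝ) : Prop :=
  0 < r ∧ normalModulus Ω r < √(2 - 2 * Θ)

/-- The tangent space to `∂Ω` at `X`, as a linear hyperplane of the ambient space. -/
def tangentSpace (Ω : Set F) (X : F) : Submodule ℝ F := (ℝ ∙ unitNormal Ω X)ᗮ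

/-- `[Y]_X`, the orthogonal projection of `Y - X` to the tangent space at `X`. -/
def bracket (Ω : Set F) (X Y : F) : tangentSpace Ω X :=
  (ℝ ∙ unitNormal Ω X)ᗮ.orthogonalProjectionOnto (Y - X)

/-- The hyperplane that supports `A` at a point of `A` at which `w` is an outward normal. -/
def supportingHyperplane (A : Set F) (w : F) : Set F :=
  {x | ∃ a ∈ A, (∀ b ∈ A, ⟪b, w⟫_ℝ ≤ ⟪a, w⟫_ℝ) ∧ ⟪x, w⟫_ℝ = ⟪a, w⟫_ℝ}

/-- `l(A, w)`, the length of the longest segment parallel to `w` with end points in `A`. -/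
def maxSegmentLength (A : Set F) (w : F) : ℝ :=
  sSup {t : ℝ | ∃ y₁ ∈ A, ∃ y₂ ∈ A, y₁ - y₂ = ‖y₁ - y₂‖ • w ∧ t = ‖y₁ - y₂‖}

/-- The `c`-transform `v^c(Z) = sup {-c(X, Z) - v(X) : X ∈ B_R(0)}`. -/
def cTransform (R : ℝ) (v : F → EReal) (Z : F) : EReal :=
  ⨆ X ∈ Metric.ball (0 : F) R, (((-cost X Z : ℝ) : EReal) - v X)

/-- `u` is `c`-convex on `B_R(0)`: it is the `c`-transform there of a function
`v : B_R(0) → ℝ ∪ {∞}`. A `c`-transform that is not identically infinite is real valued, since the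
cost is bounded on the ball, so `u` is taken real valued; its values off the ball are not used. -/
def IsCConvex (R : ℝ) (u : F → ℝ) : Prop :=
  ∃ v : F → EReal, (∀ X ∈ Metric.ball (0 : F) R, v X ≠ ⊥) ∧
    ∀ Z ∈ Metric.ball (0 : F) R, (u Z : EReal) = cTransform R v Z

/-- The `c`-subdifferential of `u` at `X` with respect to `Ω`. -/
def cSubdiff (Ω : Set F) (u : F → ℝ) (X : F) : Set F :=
  {Z ∈ frontier Ω | ∀ Y ∈ frontier Ω, -cost Y Z + cost X Z + u X ≤ u Y}

/-- The image of a set `A` under the `c`-subdifferential of `u`. -/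
def cSubdiffImage (Ω : Set F) (u : F → ℝ) (A : Set F) : Set F :=
  ⋃ X ∈ A, cSubdiff Ω u X

/-- The function `m₀(X) = -c(X, Z) + h`. -/
def mZero (Z : F) (h : ℝ) (X : F) : ℝ := -cost X Z + h

/-- The section `S = {X ∈ ∂Ω : u(X) ≤ m₀(X)}`. -/
def cSection (Ω : Set F) (u : F → ℝ) (Z : F) (h : ℝ) : Set F :=
  {X ∈ frontier Ω | u X ≤ mZero Z h X}

/-- The projected section `[S]_Z`, a subset of the tangent space at `Z`. -/
def projSection (Ω : Set F) (u : F → ℝ) (Z : F) (h : ℝ) : Set (tangentSpace Ω Z) :=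
  bracket Ω Z '' cSection Ω u Z h

end Definitions

end

end BoundaryTransport

/-!
The estimate is the boundary version of the classical bound `|f X₀|ⁿ ≤ C |∂f(S)| |S| d / l` for a
convex function `f` that is negative inside its section `S = {f ≤ 0}`: the subgradients of the cone
over `S` with vertex `(X₀, f X₀)` are subgradients of `f`, and they form a multiple of the polar body
of `S` about `X₀`, whose volume is at least a constant times `l / (d |S|)`.

Put `f = u - m₀`. Then `Z` is in the `c`-subdifferential of `u` at `X` exactly when the affine
function with gradient `Z - Z₀` touching `f` at `X` lies below `f` on the whole boundary
(`cSubdiff_eq_linearSubdiff`). Everything rests on one observation. Let `M` be a convex combination of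
boundary points and let `M + τ N_P`, with `τ ≥ 0`, be a boundary point over it in the direction of the
normal at `P`. Since `⟪N_P, Y - P⟫ ≤ 0` on `Ω`, moving by `τ N_P` has a sign:

* relative to the affine function with gradient `P - Z₀`, `f` is convex along such points
  (`IsC1Body.le_convex_combination`). For `P = Z₀` this makes the projected section convex. For a
  general `P = Z` it shows that a gradient `Z - Z₀` whose affine function, started at `(X₀, f X₀)`, is
  negative on `S` is a subgradient at a point of `S`: the global minimum of `f - ⟪·, Z - Z₀⟫` lies
  near `Z` by the localization hypothesis, and the curve from `X₀` to it cannot leave `S`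
  (`IsC1Body.exists_mem_linearSubdiff_of_lt`);
* the subgradients at `P`, and the gradients of the cone over `S` with vertex at `P`, are convex in
  the coordinates on the tangent space at `P` (`IsC1Body.inner_lift_le`).

For a unit tangent vector `v`, at the point `Y` of `S` where `v` is largest there is a subgradient
`Z - Z₀ = l v - κ N_Y` (`IsC1Body.exists_subgradient_parallel`). The term `κ N_Y` is not small, but
contracting `Z` towards `Z₀` along the boundary by a factor `η` depending only on `Ω` and the
dimension makes it as small as desired relative to `l v`, because the boundary is flat near `Z₀`,
uniformly in `Z₀`. This gives a dual vector almost parallel to `v` of length at least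
`η |f X₀| / (2 d_v)`, where `d_v` is the extent of `S` from `X₀` in the direction `v`
(`IsC1Body.exists_dual_vector`). The dual vectors of an orthonormal family span a simplex, which is
convexly filled and lifted to the boundary at `X₀`; hence the subgradients over `S` have measure at
least a constant times `|f X₀|ⁿ / ∏ d_v` (`IsC1Body.le_hausdorffMeasure_linearSubdiff`).

Finally the orthonormal family is chosen to start with `w` and to continue with the direction in
which the projected section extends farthest from `X₀`. The points realizing these extents and a
chord parallel to `w` span a parallelepiped with triangular coordinate matrix, so the section has
measure at least a constant times `l ∏ d_v`, the product being over the vectors other than `w`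
(`exists_orthonormal_le_volume`). Multiplying the two bounds leaves `l / d_w`.
-/

namespace BoundaryTransport

open Filter Topology

/-! ### Normals of a convex body with `C¹` boundary -/

section Geometry

variable {F : Type*} [NormedAddCommGroup F] [InnerProductSpace ℝ F] {Ω : Set F}

/-- A compact convex set with `C¹` boundary. -/
structure IsC1Body (Ω : Set F) : Prop where
  isCompact : IsCompact Ω
  convex : Convex ℝ Ω
  hasC1Boundary : HasC1Boundary Ω

namespace IsC1Body

theorem frontier_subset (hΩ : IsC1Body Ω) : frontier Ω ⊆ Ω :=
  hΩ.isCompact.isClosed.frontier_subset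

theorem isCompact_frontier (hΩ : IsC1Body Ω) : IsCompact (frontier Ω) :=
  hΩ.isCompact.of_isClosed_subset isClosed_frontier hΩ.frontier_subset

/-- From a point of `Ω` the boundary is reached by moving a nonnegative multiple of a given
nonzero vector. -/
theorem exists_lift (hΩ : IsC1Body Ω) {M V : F} (hM : M ∈ Ω) (hV : V ≠ 0) :
    ∃ τ : ℝ, 0 ≤ τ ∧ M + τ • V ∈ frontier Ω := by
  have hcont : Continuous fun τ : ℝ => M + τ • V := by fun_prop
  obtain ⟨B, hB⟩ := hΩ.isCompact.isBounded.exists_norm_le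
  have hVpos : 0 < ‖V‖ := norm_pos_iff.2 hV
  have hK : IsCompact (Ici (0 : ℝ) ∩ (fun τ : ℝ => M + τ • V) ⁻¹' Ω) := by
    refine isCompact_Icc.of_isClosed_subset (isClosed_Ici.inter
      (hΩ.isCompact.isClosed.preimage hcont)) (?_ : _ ⊆ Icc 0 ((B + ‖M‖) / ‖V‖))
    rintro τ ⟨hτ0, hτ⟩
    refine ⟨hτ0, (le_div_iff₀ hVpos).2 ?_⟩
    have h1 : ‖τ • V‖ ≤ ‖M + τ • V‖ + ‖M‖ := by
      simpa using norm_sub_le (M + τ • V) M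
    rw [norm_smul, Real.norm_of_nonneg hτ0] at h1
    linarith [hB _ hτ]
  obtain ⟨τ, ⟨hτ0, hτ⟩, hmax⟩ := hK.exists_isGreatest
    ⟨0, mem_Ici.2 le_rfl, by simpa using hM⟩
  refine ⟨τ, hτ0, subset_closure hτ, fun hint => ?_⟩
  have h1 : ∀ᶠ s in 𝓝[>] τ, M + s • V ∈ Ω := nhdsWithin_le_nhds
    (hcont.tendsto τ (mem_interior_iff_mem_nhds.1 hint))
  obtain ⟨s, hs, hsτ⟩ := (h1.and self_mem_nhdsWithin).exists
  have hsτ' : τ < s := hsτ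
  exact absurd (hmax ⟨hτ0.trans hsτ'.le, hs⟩) (not_le.2 hsτ')

/-- At a boundary point there is a supporting functional, namely the differential of a local
defining function, and every direction on which it is negative points into `Ω`. -/
theorem exists_functional (hΩ : IsC1Body Ω) {X : F} (hX : X ∈ frontier Ω) :
    ∃ L : F →L[ℝ] ℝ, L ≠ 0 ∧ (∀ Y ∈ Ω, L (Y - X) ≤ 0) ∧
      ∀ ξ, L ξ < 0 → ∀ᶠ t : ℝ in 𝓝[>] 0, X + t • ξ ∈ Ω := by
  obtain ⟨U, φ, hU, hXU, hφ, hne, hΩU⟩ := hΩ.hasC1Boundary X hX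
  have hXΩ : X ∈ Ω := hΩ.frontier_subset hX
  have hdiff : DifferentiableAt ℝ φ X :=
    (hφ.differentiableOn one_ne_zero).differentiableAt (hU.mem_nhds hXU)
  have hle : φ X ≤ 0 := (hΩU ▸ (⟨hXΩ, hXU⟩ : X ∈ Ω ∩ U) : X ∈ {Y ∈ U | φ Y ≤ 0}).2
  have hzero : φ X = 0 := by
    refine le_antisymm hle (not_lt.1 fun hlt => ?_)
    have h1 : ∀ᶠ Y in 𝓝 X, Y ∈ Ω := by
      filter_upwards [hdiff.continuousAt.eventually (gt_mem_nhds hlt), hU.mem_nhds hXU]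
        with Y h1 h2
      exact (hΩU.symm ▸ (⟨h2, h1.le⟩ : Y ∈ {Y ∈ U | φ Y ≤ 0}) : Y ∈ Ω ∩ U).1
    exact hX.2 (mem_interior_iff_mem_nhds.2 h1)
  have hline (ξ : F) : HasDerivAt (fun t : ℝ => φ (X + t • ξ)) (fderiv ℝ φ X ξ) 0 := by
    have h2 : HasDerivAt (fun t : ℝ => X + t • ξ) ξ 0 := by
      simpa using ((hasDerivAt_id (0 : ℝ)).smul_const ξ).const_add X
    have h1 : HasFDerivAt φ (fderiv ℝ φ X) (X + (0 : ℝ) • ξ) := by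
      simpa using hdiff.hasFDerivAt
    exact h1.comp_hasDerivAt 0 h2
  have hcont (ξ : F) : Tendsto (fun t : ℝ => X + t • ξ) (𝓝[>] 0) (𝓝 X) := by
    have : Continuous fun t : ℝ => X + t • ξ := by fun_prop
    simpa using (this.tendsto 0).mono_left nhdsWithin_le_nhds
  have hslope (ξ : F) : Tendsto (fun t : ℝ => t⁻¹ * φ (X + t • ξ)) (𝓝[>] 0)
      (𝓝 (fderiv ℝ φ X ξ)) := by
    have := (hline ξ).tendsto_slope_zero_right
    simpa [hzero] using this
  refine ⟨fderiv ℝ φ X, hne, fun Y hY => ?_, fun ξ hξ => ?_⟩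
  · refine le_of_tendsto (hslope (Y - X)) ?_
    have h1 : ∀ᶠ t : ℝ in 𝓝[>] 0, t < 1 :=
      nhdsWithin_le_nhds (gt_mem_nhds one_pos)
    filter_upwards [h1, self_mem_nhdsWithin, hcont (Y - X) (hU.mem_nhds hXU)] with t ht1 ht0 htU
    have ht0' : 0 < t := ht0
    have hmem : X + t • (Y - X) ∈ Ω := hΩ.convex.add_smul_sub_mem hXΩ hY ⟨ht0'.le, ht1.le⟩
    have := (hΩU ▸ (⟨hmem, htU⟩ : X + t • (Y - X) ∈ Ω ∩ U) :
      X + t • (Y - X) ∈ {Y ∈ U | φ Y ≤ 0}).2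
    exact mul_nonpos_of_nonneg_of_nonpos (inv_nonneg.2 ht0'.le) this
  · filter_upwards [(hslope ξ).eventually (gt_mem_nhds hξ), self_mem_nhdsWithin,
      hcont ξ (hU.mem_nhds hXU)] with t ht ht0 htU
    have ht0' : 0 < t := ht0
    have h3 : φ (X + t • ξ) ≤ 0 := by
      by_contra hcon
      push Not at hcon
      have : 0 < t⁻¹ * φ (X + t • ξ) := by positivity
      linarith
    exact (hΩU.symm ▸ (⟨htU, h3⟩ : X + t • ξ ∈ {Y ∈ U | φ Y ≤ 0}) : X + t • ξ ∈ Ω ∩ U).1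

variable [CompleteSpace F]

theorem exists_normal (hΩ : IsC1Body Ω) {X : F} (hX : X ∈ frontier Ω) :
    ∃ V, outwardNormals Ω X = {V} ∧
      ∀ ξ, ⟪V, ξ⟫_ℝ < 0 → ∀ᶠ t : ℝ in 𝓝[>] 0, X + t • ξ ∈ Ω := by
  obtain ⟨L, hL, hsup, hin⟩ := hΩ.exists_functional hX
  set G : F := (InnerProductSpace.toDual ℝ F).symm L with hG
  have hLG (x : F) : L x = ⟪G, x⟫_ℝ := by simp [hG]
  have hG0 : G ≠ 0 := by simpa [hG] using hL
  have hGpos : 0 < ‖G‖ := norm_pos_iff.2 hG0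
  refine ⟨‖G‖⁻¹ • G, ?_, fun ξ hξ => hin ξ ?_⟩
  · refine Set.eq_singleton_iff_unique_mem.2 ⟨⟨norm_smul_inv_norm hG0, fun Y hY => ?_⟩, ?_⟩
    · rw [real_inner_smul_left, ← hLG]
      exact mul_nonpos_of_nonneg_of_nonpos (inv_nonneg.2 hGpos.le) (hsup Y hY)
    · rintro V ⟨hV1, hV⟩
      -- `V` is nonpositive on the half space `⟪G, ·⟫ < 0`; test it on `V' - s • G` with `V'` the
      -- component of `V` orthogonal to `G`.
      have key (ξ : F) (hξ : ⟪G, ξ⟫_ℝ < 0) : ⟪V, ξ⟫_ℝ ≤ 0 := by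
        obtain ⟨t, ht, ht0⟩ := ((hin ξ (by rwa [hLG])).and self_mem_nhdsWithin).exists
        have h1 := hV _ ht
        rw [add_sub_cancel_left, real_inner_smul_right] at h1
        have ht0' : 0 < t := ht0
        exact nonpos_of_mul_nonpos_right h1 ht0'
      have key' (ξ : F) (hξ : ⟪G, ξ⟫_ℝ ≤ 0) : ⟪V, ξ⟫_ℝ ≤ 0 := by
        have hc : Tendsto (fun s : ℝ => ⟪V, ξ - s • G⟫_ℝ) (𝓝[>] 0) (𝓝 ⟪V, ξ⟫_ℝ) := by
          have : Continuous fun s : ℝ => ⟪V, ξ - s • G⟫_ℝ := by fun_prop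
          simpa using (this.tendsto 0).mono_left nhdsWithin_le_nhds
        refine le_of_tendsto hc ?_
        filter_upwards [self_mem_nhdsWithin] with s hs
        have hs' : 0 < s := hs
        refine key _ ?_
        rw [inner_sub_right, real_inner_smul_right, real_inner_self_eq_norm_sq]
        nlinarith [mul_pos hs' (pow_pos hGpos 2)]
      set c : ℝ := ⟪G, V⟫_ℝ / ‖G‖ ^ 2 with hc
      have horth : ⟪G, V - c • G⟫_ℝ = 0 := by
        rw [inner_sub_right, real_inner_smul_right, real_inner_self_eq_norm_sq, hc]
        field_simp
        ring
      have h2 := key' _ horth.le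
      have h3 : ‖V - c • G‖ ^ 2 ≤ 0 := by
        rw [← real_inner_self_eq_norm_sq, inner_sub_left, real_inner_smul_left, horth]
        linarith
      have h4 : V = c • G := by
        have : ‖V - c • G‖ = 0 := by nlinarith [norm_nonneg (V - c • G)]
        exact sub_eq_zero.1 (norm_eq_zero.1 this)
      have hGV : 0 ≤ ⟪G, V⟫_ℝ := by
        have := key' (-G) (by simp)
        rw [inner_neg_right, real_inner_comm] at this
        linarith
      have hc0 : 0 ≤ c := by positivity
      have h5 : c * ‖G‖ = 1 := by
        rw [h4, norm_smul, Real.norm_of_nonneg hc0] at hV1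
        exact hV1
      rw [h4, eq_inv_of_mul_eq_one_left h5]
  · rw [real_inner_smul_left] at hξ
    rw [hLG]
    by_contra hcon
    push Not at hcon
    have : 0 ≤ ‖G‖⁻¹ * ⟪G, ξ⟫_ℝ := by positivity
    linarith

theorem unitNormal_mem (hΩ : IsC1Body Ω) {X : F} (hX : X ∈ frontier Ω) :
    unitNormal Ω X ∈ outwardNormals Ω X := by
  obtain ⟨V, hV, -⟩ := hΩ.exists_normal hX
  exact Classical.epsilon_spec (p := fun V => V ∈ outwardNormals Ω X) ⟨V, hV ▸ rfl⟩

theorem norm_unitNormal (hΩ : IsC1Body Ω) {X : F} (hX : X ∈ frontier Ω) :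
    ‖unitNormal Ω X‖ = 1 :=
  (hΩ.unitNormal_mem hX).1

theorem inner_unitNormal_le (hΩ : IsC1Body Ω) {X Y : F} (hX : X ∈ frontier Ω) (hY : Y ∈ Ω) :
    ⟪unitNormal Ω X, Y - X⟫_ℝ ≤ 0 :=
  (hΩ.unitNormal_mem hX).2 Y hY

theorem eq_unitNormal (hΩ : IsC1Body Ω) {X V : F} (hX : X ∈ frontier Ω)
    (hV : V ∈ outwardNormals Ω X) : V = unitNormal Ω X := by
  obtain ⟨W, hW, -⟩ := hΩ.exists_normal hX
  have h := hΩ.unitNormal_mem hX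
  rw [hW] at h hV
  exact hV.trans h.symm

theorem eventually_mem (hΩ : IsC1Body Ω) {X ξ : F} (hX : X ∈ frontier Ω)
    (hξ : ⟪unitNormal Ω X, ξ⟫_ℝ < 0) : ∀ᶠ t : ℝ in 𝓝[>] 0, X + t • ξ ∈ Ω := by
  obtain ⟨W, hW, hin⟩ := hΩ.exists_normal hX
  have h := hΩ.unitNormal_mem hX
  rw [hW] at h
  refine hin ξ ?_
  rwa [← (h : unitNormal Ω X = W)]

/-- A tangent vector `ξ` at a boundary point is the limit of difference quotients of boundary
points. -/
theorem exists_tangent_seq (hΩ : IsC1Body Ω) {X ξ : F} (hX : X ∈ frontier Ω)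
    (hξ : ⟪unitNormal Ω X, ξ⟫_ℝ = 0) :
    ∃ (t : ℕ → ℝ) (ξ' : ℕ → F), (∀ k, 0 < t k) ∧ Tendsto t atTop (𝓝 0) ∧
      Tendsto ξ' atTop (𝓝 ξ) ∧ ∀ k, X + t k • ξ' k ∈ frontier Ω := by
  set V := unitNormal Ω X with hV
  have hV1 : ‖V‖ = 1 := hΩ.norm_unitNormal hX
  have step (k : ℕ) : ∃ (t : ℝ) (δ : ℝ), 0 < t ∧ t < 1 / ((k : ℝ) + 1) ∧
      |δ| ≤ 1 / ((k : ℝ) + 1) ∧ X + t • (ξ + δ • V) ∈ frontier Ω := by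
    set e : ℝ := 1 / ((k : ℝ) + 1) with he
    have he0 : 0 < e := by positivity
    have hin : ∀ᶠ t : ℝ in 𝓝[>] 0, X + t • (ξ + (-e) • V) ∈ Ω := by
      refine hΩ.eventually_mem hX ?_
      rw [inner_add_right, hξ, real_inner_smul_right, real_inner_self_eq_norm_sq, hV1]
      linarith
    have h1 : ∀ᶠ t : ℝ in 𝓝[>] 0, t < e := nhdsWithin_le_nhds (gt_mem_nhds he0)
    obtain ⟨t, ⟨ht, hte⟩, ht0⟩ := ((hin.and h1).and self_mem_nhdsWithin).exists
    have ht0' : 0 < t := ht0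
    obtain ⟨τ, hτ0, hτ⟩ := hΩ.exists_lift ht (V := V) (norm_pos_iff.1 (hV1 ▸ one_pos))
    have hle := hΩ.inner_unitNormal_le hX (hΩ.frontier_subset hτ)
    have hle' : τ ≤ t * e := by
      have h2 : X + t • (ξ + (-e) • V) + τ • V - X = t • ξ + (τ - t * e) • V := by module
      rw [h2, inner_add_right, real_inner_smul_right, real_inner_smul_right, hξ, ← hV,
        real_inner_self_eq_norm_sq, hV1] at hle
      linarith
    refine ⟨t, -e + τ / t, ht0', hte, abs_le.2 ⟨?_, ?_⟩, ?_⟩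
    · have : 0 ≤ τ / t := by positivity
      linarith
    · have : τ / t ≤ e := by rwa [div_le_iff₀ ht0', mul_comm]
      linarith
    · convert hτ using 1
      rw [add_smul, ← add_assoc, smul_add, smul_smul, mul_div_cancel₀ _ ht0'.ne', ← add_assoc]
  choose t δ ht0 hte hδ hmem using step
  have h0 : Tendsto (fun k : ℕ => 1 / ((k : ℝ) + 1)) atTop (𝓝 0) :=
    tendsto_one_div_add_atTop_nhds_zero_nat
  refine ⟨t, fun k => ξ + δ k • V, ht0, ?_, ?_, hmem⟩
  · exact squeeze_zero (fun k => (ht0 k).le) (fun k => (hte k).le) h0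
  · have hδ0 : Tendsto δ atTop (𝓝 0) := squeeze_zero_norm hδ h0
    simpa using (hδ0.smul_const V).const_add ξ

theorem norm_sub_le_normalModulus (hΩ : IsC1Body Ω) {r : ℝ} {X₁ X₂ : F} (h₁ : X₁ ∈ frontier Ω)
    (h₂ : X₂ ∈ frontier Ω) (h : ‖X₁ - X₂‖ < r) :
    ‖unitNormal Ω X₁ - unitNormal Ω X₂‖ ≤ normalModulus Ω r := by
  refine le_csSup ⟨2, ?_⟩ ⟨X₁, h₁, X₂, h₂, h, rfl⟩
  rintro _ ⟨Y₁, hY₁, Y₂, hY₂, -, rfl⟩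
  have := norm_sub_le (unitNormal Ω Y₁) (unitNormal Ω Y₂)
  rw [hΩ.norm_unitNormal hY₁, hΩ.norm_unitNormal hY₂] at this
  linarith

/-- Normals at points closer than an admissible radius for `Θ` have inner product above `Θ`. -/
theorem lt_inner_unitNormal (hΩ : IsC1Body Ω) {Θ r : ℝ} (hr : IsAdmissibleRadius Ω Θ r)
    {X₁ X₂ : F} (h₁ : X₁ ∈ frontier Ω) (h₂ : X₂ ∈ frontier Ω) (h : ‖X₁ - X₂‖ < r) :
    Θ < ⟪unitNormal Ω X₁, unitNormal Ω X₂⟫_ℝ := by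
  have h3 := (hΩ.norm_sub_le_normalModulus h₁ h₂ h).trans_lt hr.2
  rw [Real.lt_sqrt (norm_nonneg _), norm_sub_sq_real, hΩ.norm_unitNormal h₁,
    hΩ.norm_unitNormal h₂] at h3
  linarith

/-- The unit normal is uniformly continuous on the boundary. -/
theorem exists_norm_unitNormal_sub_le [ProperSpace F] (hΩ : IsC1Body Ω) {ε : ℝ} (hε : 0 < ε) :
    ∃ ρ > 0, ∀ X₁ ∈ frontier Ω, ∀ X₂ ∈ frontier Ω, ‖X₁ - X₂‖ < ρ →
      ‖unitNormal Ω X₁ - unitNormal Ω X₂‖ ≤ ε := by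
  by_contra! hcon
  have hcon' (k : ℕ) := hcon (1 / ((k : ℝ) + 1)) (by positivity)
  choose X hX Y hY hXY hN using hcon'
  have hcpt : IsCompact ((frontier Ω ×ˢ frontier Ω) ×ˢ
      (Metric.sphere (0 : F) 1 ×ˢ Metric.sphere (0 : F) 1)) :=
    (hΩ.isCompact_frontier.prod hΩ.isCompact_frontier).prod
      ((isCompact_sphere _ _).prod (isCompact_sphere _ _))
  obtain ⟨⟨⟨A, B⟩, ⟨V, W⟩⟩, ⟨⟨hA, -⟩, -⟩, s, hs, hlim⟩ := hcpt.tendsto_subseq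
    (x := fun k => ((X k, Y k), (unitNormal Ω (X k), unitNormal Ω (Y k))))
    (fun k => ⟨⟨hX k, hY k⟩, by simpa using hΩ.norm_unitNormal (hX k),
      by simpa using hΩ.norm_unitNormal (hY k)⟩)
  have hlX : Tendsto (fun k => X (s k)) atTop (𝓝 A) :=
    ((continuous_fst.comp continuous_fst).tendsto _).comp hlim
  have hlY : Tendsto (fun k => Y (s k)) atTop (𝓝 B) :=
    ((continuous_snd.comp continuous_fst).tendsto _).comp hlim
  have hlV : Tendsto (fun k => unitNormal Ω (X (s k))) atTop (𝓝 V) :=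
    ((continuous_fst.comp continuous_snd).tendsto _).comp hlim
  have hlW : Tendsto (fun k => unitNormal Ω (Y (s k))) atTop (𝓝 W) :=
    ((continuous_snd.comp continuous_snd).tendsto _).comp hlim
  have hAB : A = B := by
    have h0 : Tendsto (fun k => X (s k) - Y (s k)) atTop (𝓝 0) :=
      squeeze_zero_norm (fun k => (hXY (s k)).le)
        (tendsto_one_div_add_atTop_nhds_zero_nat.comp hs.tendsto_atTop)
    exact sub_eq_zero.1 (tendsto_nhds_unique (hlX.sub hlY) h0)
  subst hAB
  have hmem {x : ℕ → F} {v : F} (hx : ∀ k, x k ∈ frontier Ω) (hxA : Tendsto x atTop (𝓝 A))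
      (hv : Tendsto (fun k => unitNormal Ω (x k)) atTop (𝓝 v)) : v = unitNormal Ω A := by
    refine hΩ.eq_unitNormal hA ⟨?_, fun Z hZ => ?_⟩
    · exact tendsto_nhds_unique hv.norm (by simp [hΩ.norm_unitNormal (hx _)])
    · exact le_of_tendsto (hv.inner (hxA.const_sub Z))
        (Eventually.of_forall fun k => hΩ.inner_unitNormal_le (hx k) hZ)
  have hVW : V = W := (hmem (fun k => hX (s k)) hlX hlV).trans
    (hmem (fun k => hY (s k)) hlY hlW).symm
  have h1 : ε ≤ ‖V - W‖ := ge_of_tendsto (hlV.sub hlW).norm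
    (Eventually.of_forall fun k => (hN (s k)).le)
  rw [hVW, sub_self, norm_zero] at h1
  linarith

/-- Near a boundary point the boundary is flat to first order. -/
theorem neg_inner_unitNormal_le (hΩ : IsC1Body Ω) {X Y : F} (hX : X ∈ frontier Ω)
    (hY : Y ∈ frontier Ω) :
    -⟪unitNormal Ω X, Y - X⟫_ℝ ≤ ‖unitNormal Ω X - unitNormal Ω Y‖ * ‖Y - X‖ := by
  have h1 := hΩ.inner_unitNormal_le hY (hΩ.frontier_subset hX)
  have h2 := real_inner_le_norm (unitNormal Ω Y - unitNormal Ω X) (Y - X)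
  rw [norm_sub_rev, inner_sub_left] at h2
  rw [← neg_sub Y X, inner_neg_right] at h1
  linarith

/-- The distance to a boundary point `X` at most triples when moving outwards along a direction
making a small angle with the normal at `X`. -/
theorem norm_lift_sub_le (hΩ : IsC1Body Ω) {X M V : F} {τ : ℝ} (hX : X ∈ frontier Ω)
    (hτ : 0 ≤ τ) (hV : ‖V‖ = 1) (hVX : 35 / 36 ≤ ⟪unitNormal Ω X, V⟫_ℝ)
    (hlift : M + τ • V ∈ frontier Ω) :
    τ ≤ 36 / 35 * ‖M - X‖ ∧ ‖M + τ • V - X‖ ≤ 3 * ‖M - X‖ := by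
  have h1 := hΩ.inner_unitNormal_le hX (hΩ.frontier_subset hlift)
  have h3 : M + τ • V - X = (M - X) + τ • V := by abel
  rw [h3, inner_add_right, real_inner_smul_right] at h1
  have h2 := neg_le_of_abs_le (abs_real_inner_le_norm (unitNormal Ω X) (M - X))
  rw [hΩ.norm_unitNormal hX, one_mul] at h2
  have h4 : τ ≤ 36 / 35 * ‖M - X‖ := by nlinarith
  refine ⟨h4, ?_⟩
  rw [h3]
  refine (norm_add_le _ _).trans ?_
  rw [norm_smul, hV, Real.norm_of_nonneg hτ]
  nlinarith [norm_nonneg (M - X)]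

/-- Two boundary points near a boundary point `P` are joined by a continuous curve in the boundary
that lies above the segment between them in the direction of the normal at `P`. -/
theorem exists_path (hΩ : IsC1Body Ω) {r : ℝ} (hr : IsAdmissibleRadius Ω (35 / 36) r)
    {P X₀ X₁ : F} (hP : P ∈ frontier Ω) (h₀ : X₀ ∈ frontier Ω) (h₁ : X₁ ∈ frontier Ω)
    (h₀P : ‖X₀ - P‖ < r / 3) (h₁P : ‖X₁ - P‖ < r / 3) :
    ∃ γ : ℝ → F, ContinuousOn γ (Icc 0 1) ∧ γ 0 = X₀ ∧ γ 1 = X₁ ∧ ∀ s ∈ Icc (0 : ℝ) 1,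
      γ s ∈ frontier Ω ∧
        ∃ τ : ℝ, 0 ≤ τ ∧ γ s = ((1 - s) • X₀ + s • X₁) + τ • unitNormal Ω P := by
  set V := unitNormal Ω P with hV
  have hr0 := hr.1
  have hV1 : ‖V‖ = 1 := hΩ.norm_unitNormal hP
  have hV0 : V ≠ 0 := norm_pos_iff.1 (hV1 ▸ one_pos)
  have hMΩ (s : ℝ) (hs : s ∈ Icc (0 : ℝ) 1) : (1 - s) • X₀ + s • X₁ ∈ Ω :=
    hΩ.convex (hΩ.frontier_subset h₀) (hΩ.frontier_subset h₁) (sub_nonneg.2 hs.2) hs.1 (by ring)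
  have hex (s : ℝ) : ∃ τ : ℝ, s ∈ Icc (0 : ℝ) 1 →
      0 ≤ τ ∧ ((1 - s) • X₀ + s • X₁) + τ • V ∈ frontier Ω := by
    by_cases hs : s ∈ Icc (0 : ℝ) 1
    · obtain ⟨τ, h⟩ := hΩ.exists_lift (hMΩ s hs) hV0
      exact ⟨τ, fun _ => h⟩
    · exact ⟨0, fun h => absurd h hs⟩
  choose τ hτ using hex
  have hnear (s : ℝ) (hs : s ∈ Icc (0 : ℝ) 1) :
      ‖(1 - s) • X₀ + s • X₁ + τ s • V - P‖ < r := by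
    have h1 := (hΩ.norm_lift_sub_le hP (hτ s hs).1 hV1
      (by rw [real_inner_self_eq_norm_sq, hV1]; norm_num) (hτ s hs).2).2
    have h2 : (1 - s) • X₀ + s • X₁ - P ∈ Metric.ball (0 : F) (r / 3) := by
      have : (1 - s) • X₀ + s • X₁ - P = (1 - s) • (X₀ - P) + s • (X₁ - P) := by module
      rw [this]
      exact convex_ball _ _ (by simpa using h₀P) (by simpa using h₁P) (sub_nonneg.2 hs.2) hs.1
        (by ring)
    rw [mem_ball_zero_iff] at h2
    linarith
  have hang (s : ℝ) (hs : s ∈ Icc (0 : ℝ) 1) :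
      35 / 36 < ⟪unitNormal Ω ((1 - s) • X₀ + s • X₁ + τ s • V), V⟫_ℝ :=
    hΩ.lt_inner_unitNormal hr (hτ s hs).2 hP (hnear s hs)
  -- The height over the segment is Lipschitz.
  have hlip (s t : ℝ) (hs : s ∈ Icc (0 : ℝ) 1) (ht : t ∈ Icc (0 : ℝ) 1) :
      τ t - τ s ≤ 36 / 35 * (|t - s| * ‖X₁ - X₀‖) := by
    have h1 := hΩ.inner_unitNormal_le (hτ s hs).2 (hΩ.frontier_subset (hτ t ht).2)
    set W := unitNormal Ω ((1 - s) • X₀ + s • X₁ + τ s • V) with hW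
    have h2 : (1 - t) • X₀ + t • X₁ + τ t • V - ((1 - s) • X₀ + s • X₁ + τ s • V) =
        (t - s) • (X₁ - X₀) + (τ t - τ s) • V := by module
    rw [h2, inner_add_right, real_inner_smul_right _ V] at h1
    have h3 := neg_le_of_abs_le (abs_real_inner_le_norm W ((t - s) • (X₁ - X₀)))
    rw [hW, hΩ.norm_unitNormal (hτ s hs).2, ← hW, norm_smul, Real.norm_eq_abs, one_mul] at h3
    have h4 : 0 ≤ |t - s| * ‖X₁ - X₀‖ := by positivity
    have h5 := hang s hs
    by_cases h6 : τ t - τ s ≤ 0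
    · linarith
    · push Not at h6
      nlinarith
  have hcτ : ContinuousOn τ (Icc 0 1) := by
    refine (LipschitzOnWith.of_dist_le_mul (K := ⟨36 / 35 * ‖X₁ - X₀‖, by positivity⟩)
      fun s hs t ht => ?_).continuousOn
    rw [Real.dist_eq, Real.dist_eq, abs_le]
    have h1 := hlip s t hs ht
    have h2 := hlip t s ht hs
    rw [abs_sub_comm] at h1
    change _ ≤ _ ∧ _ ≤ 36 / 35 * ‖X₁ - X₀‖ * |s - t|
    change -(36 / 35 * ‖X₁ - X₀‖ * |s - t|) ≤ _ ∧ _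
    constructor <;> linarith
  -- At the end points the height vanishes, since the normal there makes a small angle with `V`.
  have hend {X : F} (hX : X ∈ frontier Ω) (hXP : ‖X - P‖ < r / 3) {t : ℝ} (ht : 0 ≤ t)
      (hXt : X + t • V ∈ frontier Ω) : t = 0 := by
    have h1 := hΩ.inner_unitNormal_le hX (hΩ.frontier_subset hXt)
    rw [add_sub_cancel_left, real_inner_smul_right] at h1
    have h2 := hΩ.lt_inner_unitNormal hr hX hP (by linarith)
    nlinarith
  have z0 : (0 : ℝ) ∈ Icc (0 : ℝ) 1 := ⟨le_rfl, zero_le_one⟩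
  have z1 : (1 : ℝ) ∈ Icc (0 : ℝ) 1 := ⟨zero_le_one, le_rfl⟩
  refine ⟨fun s => (1 - s) • X₀ + s • X₁ + τ s • V, ?_, ?_, ?_, fun s hs =>
    ⟨(hτ s hs).2, τ s, (hτ s hs).1, rfl⟩⟩
  · have : Continuous fun s : ℝ => (1 - s) • X₀ + s • X₁ := by fun_prop
    exact this.continuousOn.add (hcτ.smul continuousOn_const)
  · have := hend h₀ h₀P (hτ 0 z0).1 (by simpa using (hτ 0 z0).2)
    simp [this]
  · have := hend h₁ h₁P (hτ 1 z1).1 (by simpa using (hτ 1 z1).2)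
    simp [this]

end IsC1Body

end Geometry

/-! ### Subdifferentials on the boundary -/

section Subdifferential

variable {F : Type*} [NormedAddCommGroup F] [InnerProductSpace ℝ F] {Ω : Set F}

/-- The points `Z` of the boundary for which the restriction to the boundary of the affine function
with gradient `Z - Z₀` that agrees with `f` at `X` lies below `f`. For `f = u - m₀` with
`m₀ = -c(·, Z₀) + h` this is the `c`-subdifferential of `u` at `X`. -/
def linearSubdiff (Ω : Set F) (Z₀ : F) (f : F → ℝ) (X : F) : Set F :=
  {Z ∈ frontier Ω | ∀ Y ∈ frontier Ω, f X + ⟪Y - X, Z - Z₀⟫_ℝ ≤ f Y}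

theorem cSubdiff_eq_linearSubdiff (u : F → ℝ) (Z₀ : F) (h : ℝ) (X : F) :
    cSubdiff Ω u X = linearSubdiff Ω Z₀ (fun Y => u Y - mZero Z₀ h Y) X := by
  ext Z
  refine and_congr_right fun _ => forall₂_congr fun Y _ => ?_
  have key : cost X Z₀ - cost Y Z₀ - cost X Z + cost Y Z + ⟪Y - X, Z - Z₀⟫_ℝ = 0 := by
    simp only [cost, norm_sub_sq_real, inner_sub_left, inner_sub_right]
    ring
  simp only [mZero]
  constructor <;> intro h1 <;> linarith

/-- The affine functions below a function only increase when the gradient is convexly combined and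
moved outwards along the normal at the point of contact. -/
theorem IsC1Body.inner_lift_le [CompleteSpace F] (hΩ : IsC1Body Ω) {X Y M : F} {τ : ℝ}
    (hX : X ∈ frontier Ω) (hY : Y ∈ Ω) (hτ : 0 ≤ τ) :
    ⟪Y - X, M + τ • unitNormal Ω X⟫_ℝ ≤ ⟪Y - X, M⟫_ℝ := by
  rw [inner_add_right, real_inner_smul_right, real_inner_comm]
  have := mul_nonpos_of_nonneg_of_nonpos hτ (hΩ.inner_unitNormal_le hX hY)
  rw [real_inner_comm] at this ⊢
  linarith

theorem continuousOn_of_linearSubdiff_nonempty (hΩ : IsC1Body Ω) {f : F → ℝ} {Z₀ : F}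
    (hZ₀ : Z₀ ∈ frontier Ω) (hne : ∀ X ∈ frontier Ω, (linearSubdiff Ω Z₀ f X).Nonempty) :
    ContinuousOn f (frontier Ω) := by
  have hlip (X Y : F) (hX : X ∈ frontier Ω) (hY : Y ∈ frontier Ω) :
      f X - f Y ≤ Metric.diam Ω * ‖X - Y‖ := by
    obtain ⟨Z, hZ, h⟩ := hne X hX
    have h1 := h Y hY
    have h2 := neg_le_of_abs_le (abs_real_inner_le_norm (Y - X) (Z - Z₀))
    have h3 : ‖Z - Z₀‖ ≤ Metric.diam Ω := by
      rw [← dist_eq_norm]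
      exact Metric.dist_le_diam_of_mem hΩ.isCompact.isBounded (hΩ.frontier_subset hZ)
        (hΩ.frontier_subset hZ₀)
    have h4 := mul_le_mul_of_nonneg_left h3 (norm_nonneg (Y - X))
    rw [norm_sub_rev X Y]
    linarith
  refine (LipschitzOnWith.of_dist_le_mul (K := ⟨Metric.diam Ω, Metric.diam_nonneg⟩)
    fun X hX Y hY => ?_).continuousOn
  rw [Real.dist_eq, dist_eq_norm, abs_le]
  change -(Metric.diam Ω * ‖X - Y‖) ≤ _ ∧ _ ≤ Metric.diam Ω * ‖X - Y‖
  have h1 := hlip X Y hX hY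
  have h2 := hlip Y X hY hX
  rw [norm_sub_rev] at h2
  constructor <;> linarith

/-- Relative to the affine function with gradient `P - Z₀`, the function `f` is convex along curves
lying above segments in the direction of the normal at `P`. -/
theorem IsC1Body.le_convex_combination [CompleteSpace F] (hΩ : IsC1Body Ω) {f : F → ℝ} {Z₀ : F}
    (hne : ∀ X ∈ frontier Ω, (linearSubdiff Ω Z₀ f X).Nonempty) {P X₁ X₂ : F} {a b τ : ℝ}
    (hP : P ∈ frontier Ω) (h₁ : X₁ ∈ frontier Ω) (h₂ : X₂ ∈ frontier Ω) (ha : 0 ≤ a) (hb : 0 ≤ b)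
    (hab : a + b = 1) (hτ : 0 ≤ τ) (hY : (a • X₁ + b • X₂) + τ • unitNormal Ω P ∈ frontier Ω) :
    f ((a • X₁ + b • X₂) + τ • unitNormal Ω P) -
        ⟪(a • X₁ + b • X₂) + τ • unitNormal Ω P, P - Z₀⟫_ℝ ≤
      a * (f X₁ - ⟪X₁, P - Z₀⟫_ℝ) + b * (f X₂ - ⟪X₂, P - Z₀⟫_ℝ) := by
  set Y := (a • X₁ + b • X₂) + τ • unitNormal Ω P with hYdef
  obtain ⟨Z, hZ, hZY⟩ := hne Y hY
  have e₁ := mul_le_mul_of_nonneg_left (hZY X₁ h₁) ha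
  have e₂ := mul_le_mul_of_nonneg_left (hZY X₂ h₂) hb
  have h3 := mul_nonpos_of_nonneg_of_nonpos hτ
    (hΩ.inner_unitNormal_le hP (hΩ.frontier_subset hZ))
  have hsum : a * ⟪X₁ - Y, Z - P⟫_ℝ + b * ⟪X₂ - Y, Z - P⟫_ℝ =
      -(τ * ⟪unitNormal Ω P, Z - P⟫_ℝ) := by
    rw [← real_inner_smul_left, ← real_inner_smul_left, ← inner_add_left,
      ← real_inner_smul_left, ← inner_neg_left]
    congr 1
    have : a • (X₁ - Y) + b • (X₂ - Y) = (a • X₁ + b • X₂) - (a + b) • Y := by module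
    rw [this, hab, hYdef]
    module
  have hsplit (X : F) : ⟪X - Y, Z - P⟫_ℝ = ⟪X - Y, Z - Z₀⟫_ℝ - ⟪X, P - Z₀⟫_ℝ + ⟪Y, P - Z₀⟫_ℝ := by
    have : Z - P = (Z - Z₀) - (P - Z₀) := by abel
    rw [this, inner_sub_right, inner_sub_left X Y (P - Z₀)]
    ring
  rw [hsplit, hsplit] at hsum
  have hb' : b = 1 - a := by linarith
  subst hb'
  linarith

/-- A gradient `Z - Z₀` whose affine function, started from the value of `f` at `X₀`, stays below
zero on the section `{f ≤ 0}` is a subgradient at some point of the section. The affine function is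
slid down until it touches `f` at a global minimum of the difference; that minimum lies near `Z`,
and along the curve over the segment from `X₀` to it in the direction of the normal at `Z` the
difference is convex, so the curve cannot leave the section. -/
theorem IsC1Body.exists_mem_linearSubdiff_of_lt [CompleteSpace F] (hΩ : IsC1Body Ω) {r : ℝ}
    (hr : IsAdmissibleRadius Ω (35 / 36) r) {f : F → ℝ} {Z₀ : F} (hZ₀ : Z₀ ∈ frontier Ω)
    (hne : ∀ X ∈ frontier Ω, (linearSubdiff Ω Z₀ f X).Nonempty)
    (hsmall : ∀ X ∈ frontier Ω, linearSubdiff Ω Z₀ f X ⊆ Metric.ball X (r / 8))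
    {X₀ Z : F} (hX₀ : X₀ ∈ frontier Ω) (hfX₀ : f X₀ ≤ 0) (hZ : Z ∈ frontier Ω)
    (hX₀Z : ‖X₀ - Z‖ < r / 3)
    (hlt : ∀ Y ∈ frontier Ω, f Y ≤ 0 → ⟪Y - X₀, Z - Z₀⟫_ℝ < -f X₀) :
    ∃ X ∈ frontier Ω, f X ≤ 0 ∧ Z ∈ linearSubdiff Ω Z₀ f X := by
  have hf := continuousOn_of_linearSubdiff_nonempty hΩ hZ₀ hne
  obtain ⟨X, hX, hmin⟩ := hΩ.isCompact_frontier.exists_isMinOn ⟨X₀, hX₀⟩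
    (f := fun Y => f Y - ⟪Y, Z - Z₀⟫_ℝ) (hf.sub (by fun_prop))
  have hXZ : Z ∈ linearSubdiff Ω Z₀ f X := by
    refine ⟨hZ, fun Y hY => ?_⟩
    have h1 : f X - ⟪X, Z - Z₀⟫_ℝ ≤ f Y - ⟪Y, Z - Z₀⟫_ℝ := hmin hY
    rw [inner_sub_left]
    linarith
  refine ⟨X, hX, not_lt.1 fun hpos => ?_, hXZ⟩
  have hdist : ‖X - Z‖ < r / 3 := by
    have h1 := hsmall X hX hXZ
    rw [Metric.mem_ball, dist_comm, dist_eq_norm] at h1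
    linarith [hr.1]
  obtain ⟨γ, hγ, hγ0, hγ1, hγs⟩ := hΩ.exists_path hr hZ hX₀ hX hX₀Z hdist
  have hfγ : ContinuousOn (fun s => f (γ s)) (Icc 0 1) :=
    hf.comp hγ fun s hs => (hγs s hs).1
  obtain ⟨s, hs, hs0⟩ := intermediate_value_Icc zero_le_one hfγ
    (by rw [hγ0, hγ1]; exact ⟨hfX₀, hpos.le⟩ : (0 : ℝ) ∈ Icc (f (γ 0)) (f (γ 1)))
  obtain ⟨hγΩ, τ, hτ, hγτ⟩ := hγs s hs
  have h1 := hΩ.le_convex_combination hne hZ hX₀ hX (sub_nonneg.2 hs.2) hs.1 (by ring) hτ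
    (hγτ ▸ hγΩ)
  rw [← hγτ] at h1
  have h2 := hlt (γ s) hγΩ (le_of_eq hs0)
  have h3 : f X - ⟪X, Z - Z₀⟫_ℝ ≤ f X₀ - ⟪X₀, Z - Z₀⟫_ℝ := hmin hX₀
  have h4 := mul_le_mul_of_nonneg_left h3 hs.1
  have hs0' : f (γ s) = 0 := hs0
  rw [inner_sub_left] at h2
  linarith

end Subdifferential

/-! ### Subgradients at supporting points of a section -/

section SupportDirections

variable {F : Type*} [NormedAddCommGroup F] [InnerProductSpace ℝ F] {Ω : Set F}

theorem isCompact_linearSubdiff (hΩ : IsC1Body Ω) (Z₀ : F) (f : F → ℝ) (X : F) :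
    IsCompact (linearSubdiff Ω Z₀ f X) := by
  refine hΩ.isCompact_frontier.inter_right
    (t := {Z | ∀ Y ∈ frontier Ω, f X + ⟪Y - X, Z - Z₀⟫_ℝ ≤ f Y}) ?_
  simp only [Set.ofPred_forall]
  refine isClosed_iInter fun Y => isClosed_iInter fun _ => ?_
  exact isClosed_le (by fun_prop) continuous_const

variable [CompleteSpace F]

/-- At a point `Y` where `v` attains its maximum on the section `{f ≤ 0}`, the value of `f` is zero,
and every tangent direction that increases `v` is nonnegative on some subgradient. Both follow by
leaving the section along boundary points tangentially to that direction. -/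
theorem IsC1Body.exists_subgradient_nonneg (hΩ : IsC1Body Ω) {f : F → ℝ} {Z₀ : F}
    (hZ₀ : Z₀ ∈ frontier Ω) (hne : ∀ X ∈ frontier Ω, (linearSubdiff Ω Z₀ f X).Nonempty)
    {Y v ξ : F} (hY : Y ∈ frontier Ω) (hfY : f Y ≤ 0)
    (hmax : ∀ Y' ∈ frontier Ω, f Y' ≤ 0 → ⟪Y', v⟫_ℝ ≤ ⟪Y, v⟫_ℝ)
    (hξ : ⟪unitNormal Ω Y, ξ⟫_ℝ = 0) (hξv : 0 < ⟪ξ, v⟫_ℝ) :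
    f Y = 0 ∧ ∃ Z ∈ linearSubdiff Ω Z₀ f Y, 0 ≤ ⟪ξ, Z - Z₀⟫_ℝ := by
  have hf := continuousOn_of_linearSubdiff_nonempty hΩ hZ₀ hne
  obtain ⟨t, ξ', ht, ht0, hξ', hmem⟩ := hΩ.exists_tangent_seq hY hξ
  have hlimY : Tendsto (fun k => Y + t k • ξ' k) atTop (𝓝 Y) := by
    simpa using (ht0.smul hξ').const_add Y
  have hlimf : Tendsto (fun k => f (Y + t k • ξ' k)) atTop (𝓝 (f Y)) :=
    (hf Y hY).tendsto.comp (tendsto_nhdsWithin_iff.2 ⟨hlimY, Eventually.of_forall hmem⟩)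
  have hpos : ∀ᶠ k in atTop, 0 < f (Y + t k • ξ' k) := by
    have h1 : Tendsto (fun k => ⟪ξ' k, v⟫_ℝ) atTop (𝓝 ⟪ξ, v⟫_ℝ) := hξ'.inner tendsto_const_nhds
    filter_upwards [h1.eventually (lt_mem_nhds hξv)] with k hk
    by_contra hcon
    have h2 := hmax _ (hmem k) (not_lt.1 hcon)
    rw [inner_add_left, real_inner_smul_left] at h2
    have := mul_pos (ht k) hk
    linarith
  have hfY0 : f Y = 0 := le_antisymm hfY (ge_of_tendsto hlimf (hpos.mono fun k hk => hk.le))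
  refine ⟨hfY0, ?_⟩
  choose Z hZ using fun k => hne _ (hmem k)
  obtain ⟨Z', hZ', s, hs, hlimZ⟩ := hΩ.isCompact_frontier.tendsto_subseq fun k => (hZ k).1
  refine ⟨Z', ⟨hZ', fun W hW => ?_⟩, ?_⟩
  · refine le_of_tendsto ((hlimf.comp hs.tendsto_atTop).add
      (((hlimY.comp hs.tendsto_atTop).const_sub W).inner (hlimZ.sub_const Z₀)))
      (Eventually.of_forall fun k => (hZ (s k)).2 W hW)
  · refine ge_of_tendsto ((hξ'.comp hs.tendsto_atTop).inner (hlimZ.sub_const Z₀)) ?_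
    filter_upwards [hs.tendsto_atTop.eventually hpos] with k hk
    have h1 := (hZ (s k)).2 Y hY
    have h2 : Y - (Y + t (s k) • ξ' (s k)) = -(t (s k) • ξ' (s k)) := by abel
    rw [h2, inner_neg_left, real_inner_smul_left, hfY0] at h1
    by_contra hcon
    push Not at hcon
    have := mul_neg_of_pos_of_neg (ht (s k)) hcon
    simp only [Function.comp_apply] at this
    linarith

/-- At a point where `v` attains its maximum on the section there is a subgradient whose tangential
part is a nonnegative multiple of the tangential part of `v`. The tangential parts of the
subgradients form a compact convex set, which cannot be separated from the ray spanned by that of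
`v`. -/
theorem IsC1Body.exists_subgradient_parallel (hΩ : IsC1Body Ω) {f : F → ℝ} {Z₀ : F}
    (hZ₀ : Z₀ ∈ frontier Ω) (hne : ∀ X ∈ frontier Ω, (linearSubdiff Ω Z₀ f X).Nonempty)
    {Y v : F} (hY : Y ∈ frontier Ω) (hfY : f Y ≤ 0)
    (hmax : ∀ Y' ∈ frontier Ω, f Y' ≤ 0 → ⟪Y', v⟫_ℝ ≤ ⟪Y, v⟫_ℝ)
    (hv : v - ⟪unitNormal Ω Y, v⟫_ℝ • unitNormal Ω Y ≠ 0) :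
    f Y = 0 ∧ ∃ Z ∈ linearSubdiff Ω Z₀ f Y, ∃ l κ : ℝ, 0 ≤ l ∧
      Z - Z₀ = l • v - κ • unitNormal Ω Y := by
  set N := unitNormal Ω Y with hN
  have hN1 : ‖N‖ = 1 := hΩ.norm_unitNormal hY
  have hNN : ⟪N, N⟫_ℝ = 1 := by rw [real_inner_self_eq_norm_sq, hN1, one_pow]
  let P : F →L[ℝ] F := ContinuousLinearMap.id ℝ F - (innerSL ℝ N).smulRight N
  have hP (x : F) : P x = x - ⟪N, x⟫_ℝ • N := by simp [P]
  have hNP (x : F) : ⟪N, P x⟫_ℝ = 0 := by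
    rw [hP, inner_sub_right, real_inner_smul_right, hNN]
    ring
  have hPN : P N = 0 := by rw [hP, hNN, one_smul, sub_self]
  have hsymm (x y : F) : ⟪P x, y⟫_ℝ = ⟪x, P y⟫_ℝ := by
    rw [hP, hP, inner_sub_left, inner_sub_right, real_inner_smul_left, real_inner_smul_right,
      real_inner_comm N x]
    ring
  have hPP (x y : F) : ⟪P x, P y⟫_ℝ = ⟪P x, y⟫_ℝ := by
    rw [hP y, inner_sub_right, real_inner_smul_right, real_inner_comm N (P x), hNP]
    ring
  have hPv : P v ≠ 0 := by rwa [hP]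
  have hPvv : 0 < ⟪P v, v⟫_ℝ := by
    rw [← hPP, real_inner_self_eq_norm_sq]
    exact pow_pos (norm_pos_iff.2 hPv) 2
  refine ⟨(hΩ.exists_subgradient_nonneg hZ₀ hne hY hfY hmax (hNP v) hPvv).1, ?_⟩
  set Q : Set F := (fun Z => P (Z - Z₀)) '' linearSubdiff Ω Z₀ f Y with hQ
  have hQc : IsCompact Q := (isCompact_linearSubdiff hΩ Z₀ f Y).image (by fun_prop)
  have hQconv : Convex ℝ Q := by
    rintro _ ⟨Z₁, hZ₁, rfl⟩ _ ⟨Z₂, hZ₂, rfl⟩ a b ha hb hab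
    obtain ⟨τ, hτ, hlift⟩ := hΩ.exists_lift (V := N) (hΩ.convex (hΩ.frontier_subset hZ₁.1)
      (hΩ.frontier_subset hZ₂.1) ha hb hab) (norm_pos_iff.1 (hN1 ▸ one_pos))
    refine ⟨_, ⟨hlift, fun W hW => ?_⟩, ?_⟩
    · have h0 : a • Z₁ + b • Z₂ + τ • N - Z₀ =
          (a • (Z₁ - Z₀) + b • (Z₂ - Z₀)) + τ • N := by
        have : Z₀ = (a + b) • Z₀ := by rw [hab, one_smul]
        conv_lhs => rw [this]
        module
      have h1 := hΩ.inner_lift_le (M := a • (Z₁ - Z₀) + b • (Z₂ - Z₀)) hY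
        (hΩ.frontier_subset hW) hτ
      rw [inner_add_right _ (a • _), real_inner_smul_right, real_inner_smul_right] at h1
      rw [h0]
      have h2 := mul_le_mul_of_nonneg_left (hZ₁.2 W hW) ha
      have h3 := mul_le_mul_of_nonneg_left (hZ₂.2 W hW) hb
      have hb' : b = 1 - a := by linarith
      subst hb'
      linarith
    · have h0 : a • Z₁ + b • Z₂ + τ • N - Z₀ =
          a • (Z₁ - Z₀) + b • (Z₂ - Z₀) + τ • N := by
        have : Z₀ = (a + b) • Z₀ := by rw [hab, one_smul]
        conv_lhs => rw [this]
        module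
      simp only [h0, map_add, map_smul, hPN, smul_zero, add_zero]
  have hRc : IsClosed ((fun l : ℝ => l • P v) '' Ici 0) :=
    (isClosedEmbedding_smul_left hPv).isClosedMap _ isClosed_Ici
  have hRconv : Convex ℝ ((fun l : ℝ => l • P v) '' Ici 0) :=
    (convex_Ici 0).is_linear_image ⟨fun a b => add_smul a b _, fun c a => by simp [mul_smul]⟩
  by_cases hdisj : Disjoint Q ((fun l : ℝ => l • P v) '' Ici 0)
  · exfalso
    obtain ⟨L, a, b, ha, hab, hb⟩ := geometric_hahn_banach_compact_closed hQconv hQc hRconv hRc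
      hdisj
    set w : F := (InnerProductSpace.toDual ℝ F).symm L with hw
    have hL (x : F) : L x = ⟪w, x⟫_ℝ := by simp [hw]
    have hb' (l : ℝ) (hl : 0 ≤ l) : b < l * ⟪w, P v⟫_ℝ := by
      rw [← real_inner_smul_right, ← hL]
      exact hb _ ⟨l, hl, rfl⟩
    have hb0 : b < 0 := by simpa using hb' 0 le_rfl
    have hwv : 0 ≤ ⟪w, P v⟫_ℝ := by
      by_contra hcon
      push Not at hcon
      have := hb' (b / ⟪w, P v⟫_ℝ) (div_nonneg_of_nonpos hb0.le hcon.le)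
      rw [div_mul_cancel₀ _ hcon.ne] at this
      exact lt_irrefl _ this
    -- Tilting the separating functional slightly towards `v` makes it positive on `v`.
    obtain ⟨B, hB⟩ := hQc.isBounded.exists_norm_le
    set D : ℝ := ‖P v‖ * |B| + 1 with hD
    have hD0 : 0 < D := by positivity
    set δ : ℝ := -a / D with hδ
    have hδ0 : 0 < δ := div_pos (by linarith) hD0
    obtain ⟨-, Z, hZ, hZ0⟩ := hΩ.exists_subgradient_nonneg hZ₀ hne hY hfY hmax
      (ξ := P (w + δ • P v)) (hNP _) (by
        rw [hsymm, inner_add_left, real_inner_smul_left, real_inner_self_eq_norm_sq]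
        have : 0 < δ * ‖P v‖ ^ 2 := mul_pos hδ0 (pow_pos (norm_pos_iff.2 hPv) 2)
        linarith)
    have hq : P (Z - Z₀) ∈ Q := ⟨Z, hZ, rfl⟩
    have h1 := ha _ hq
    rw [hL] at h1
    rw [hsymm, inner_add_left, real_inner_smul_left] at hZ0
    have h2 : ⟪P v, P (Z - Z₀)⟫_ℝ ≤ ‖P v‖ * |B| :=
      (real_inner_le_norm _ _).trans
        (mul_le_mul_of_nonneg_left ((hB _ hq).trans (le_abs_self B)) (norm_nonneg _))
    have h3 := mul_le_mul_of_nonneg_left h2 hδ0.le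
    have h4 : δ * D = -a := div_mul_cancel₀ _ hD0.ne'
    have h5 : δ * D = δ * (‖P v‖ * |B|) + δ := by rw [hD]; ring
    linarith
  · obtain ⟨_, ⟨Z, hZ, rfl⟩, l, hl, hlZ⟩ := not_disjoint_iff.1 hdisj
    refine ⟨Z, hZ, l, l * ⟪N, v⟫_ℝ - ⟪N, Z - Z₀⟫_ℝ, hl, ?_⟩
    simp only [hP] at hlZ
    have h1 : Z - Z₀ = l • (v - ⟪N, v⟫_ℝ • N) + ⟪N, Z - Z₀⟫_ℝ • N := by
      rw [hlZ, sub_add_cancel]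
    conv_lhs => rw [h1]
    module

/-- For a direction `v` tangent at `Z₀` there is a displacement `ζ` from `Z₀` into `Ω`, almost
parallel to `v`, whose affine function started at `X₀` increases by at most a fixed fraction of
`-f X₀` on the section, and whose length is at least inversely proportional to the distance from
`X₀` to the supporting hyperplane of the section with normal `v`.

It is obtained from a subgradient at the supporting point `Y`. Contracting that subgradient towards
`Z₀` by the factor `η` brings it to the region where the boundary is flat up to `ε`, so that the
component of `ζ` along the normal at `Y` is small compared with its component along `v`,
independently of the size of the section. -/
theorem IsC1Body.exists_dual_vector (hΩ : IsC1Body Ω) {r : ℝ}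
    (hr : IsAdmissibleRadius Ω (35 / 36) r) {f : F → ℝ} {Z₀ : F} (hZ₀ : Z₀ ∈ frontier Ω)
    (hne : ∀ X ∈ frontier Ω, (linearSubdiff Ω Z₀ f X).Nonempty)
    (hsmall : ∀ X ∈ frontier Ω, linearSubdiff Ω Z₀ f X ⊆ Metric.ball X (r / 8))
    {ε ρ η : ℝ} (hε : ε ≤ 1 / 18)
    (hρ : ∀ X ∈ frontier Ω, ‖X - Z₀‖ < ρ → ‖unitNormal Ω Z₀ - unitNormal Ω X‖ ≤ ε)
    (hη : 0 < η) (hη1 : η ≤ 1) (hηρ : 3 * (η * Metric.diam Ω) < ρ)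
    {X₀ Y v : F} (hX₀ : X₀ ∈ frontier Ω) (hfX₀ : f X₀ < 0) (hY : Y ∈ frontier Ω) (hfY : f Y ≤ 0)
    (hYZ₀ : ‖Y - Z₀‖ < r / 8)
    (hmax : ∀ Y' ∈ frontier Ω, f Y' ≤ 0 → ⟪Y', v⟫_ℝ ≤ ⟪Y, v⟫_ℝ)
    (hv : ‖v‖ = 1) (hvZ₀ : ⟪unitNormal Ω Z₀, v⟫_ℝ = 0) :
    ∃ (ζ : F) (l κ : ℝ), ζ = l • v - κ • unitNormal Ω Y ∧ 0 < l ∧ 0 ≤ κ ∧ κ ≤ 3 * ε * l ∧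
      η * -f X₀ / 2 ≤ l * ⟪Y - X₀, v⟫_ℝ ∧
      (∀ Y' ∈ frontier Ω, f Y' ≤ 0 → ⟪Y' - X₀, ζ⟫_ℝ ≤ η * -f X₀ / 2) ∧
      Z₀ + ζ ∈ Ω ∧ ‖ζ‖ ≤ 3 / 8 * η * r := by
  set N₀ := unitNormal Ω Z₀ with hN₀
  set N := unitNormal Ω Y with hN
  have hr0 := hr.1
  have hN1 : ‖N‖ = 1 := hΩ.norm_unitNormal hY
  have hang : 35 / 36 < ⟪N₀, N⟫_ℝ :=
    hΩ.lt_inner_unitNormal hr hZ₀ hY (by rw [norm_sub_rev]; linarith)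
  have hPv : v - ⟪N, v⟫_ℝ • N ≠ 0 := by
    intro h0
    have h1 : v = ⟪N, v⟫_ℝ • N := sub_eq_zero.1 h0
    have h2 : ⟪N, v⟫_ℝ * ⟪N₀, N⟫_ℝ = 0 := by
      rw [← real_inner_smul_right, ← h1, hvZ₀]
    have h3 : ⟪N, v⟫_ℝ = 0 := (mul_eq_zero.1 h2).resolve_right (by linarith)
    rw [h3, zero_smul] at h1
    rw [h1, norm_zero] at hv
    exact zero_ne_one hv
  obtain ⟨hfY0, Z, hZ, l', κ', hl', hZeq⟩ :=
    hΩ.exists_subgradient_parallel hZ₀ hne hY hfY hmax hPv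
  have hMΩ : Z₀ + η • (Z - Z₀) ∈ Ω := hΩ.convex.add_smul_sub_mem (hΩ.frontier_subset hZ₀)
    (hΩ.frontier_subset hZ.1) ⟨hη.le, hη1⟩
  obtain ⟨τ, hτ, hlift⟩ := hΩ.exists_lift (V := N) hMΩ (norm_pos_iff.1 (hN1 ▸ one_pos))
  have hdist := (hΩ.norm_lift_sub_le hZ₀ hτ hN1 hang.le hlift).2
  set W : F := Z₀ + η • (Z - Z₀) + τ • N with hW
  have hWZ₀ : W - Z₀ = η • (Z - Z₀) + τ • N := by rw [hW]; abel
  rw [add_sub_cancel_left, norm_smul, Real.norm_of_nonneg hη.le] at hdist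
  have hZdiam : ‖Z - Z₀‖ ≤ Metric.diam Ω := by
    rw [← dist_eq_norm]
    exact Metric.dist_le_diam_of_mem hΩ.isCompact.isBounded (hΩ.frontier_subset hZ.1)
      (hΩ.frontier_subset hZ₀)
  have hZr : ‖Z - Z₀‖ ≤ r / 4 := by
    have h1 := hsmall Y hY hZ
    rw [Metric.mem_ball, dist_eq_norm] at h1
    have h2 := norm_sub_le_norm_sub_add_norm_sub Z Y Z₀
    linarith
  have hWρ : ‖W - Z₀‖ < ρ := by nlinarith
  have hWr : ‖W - Z₀‖ ≤ 3 / 4 * η * r := by nlinarith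
  set l₁ := η * l' with hl₁
  set κ₁ := η * κ' - τ with hκ₁
  have hWeq : W - Z₀ = l₁ • v - κ₁ • N := by rw [hWZ₀, hZeq]; module
  have hl₁0 : 0 ≤ l₁ := mul_nonneg hη.le hl'
  have hN₀W : ⟪N₀, W - Z₀⟫_ℝ = -(κ₁ * ⟪N₀, N⟫_ℝ) := by
    rw [hWeq, inner_sub_right, real_inner_smul_right, real_inner_smul_right, hvZ₀]
    ring
  have hκ₁0 : 0 ≤ κ₁ := by
    have h1 := hΩ.inner_unitNormal_le hZ₀ (hΩ.frontier_subset hlift)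
    rw [← hN₀, hN₀W] at h1
    by_contra hcon
    push Not at hcon
    nlinarith
  have hWnorm : ‖W - Z₀‖ ≤ l₁ + κ₁ := by
    rw [hWeq]
    refine (norm_sub_le _ _).trans_eq ?_
    rw [norm_smul, norm_smul, hv, hN1, Real.norm_of_nonneg hl₁0, Real.norm_of_nonneg hκ₁0]
    ring
  have hκ₁le : κ₁ ≤ 3 * ε * l₁ := by
    have h1 := hΩ.neg_inner_unitNormal_le hZ₀ hlift
    have h2 := hρ W hlift hWρ
    rw [← hN₀, hN₀W, neg_neg] at h1
    have hε0 : 0 ≤ ε := (norm_nonneg _).trans h2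
    have h3 : ‖N₀ - unitNormal Ω W‖ * ‖W - Z₀‖ ≤ ε * (l₁ + κ₁) :=
      mul_le_mul h2 hWnorm (norm_nonneg _) hε0
    have h4 : κ₁ * (35 / 36) ≤ κ₁ * ⟪N₀, N⟫_ℝ := mul_le_mul_of_nonneg_left hang.le hκ₁0
    have h5 : ε * κ₁ ≤ 1 / 18 * κ₁ := mul_le_mul_of_nonneg_right hε hκ₁0
    have h6 : 0 ≤ ε * l₁ := mul_nonneg hε0 hl₁0
    linarith
  set m := -f X₀ with hm
  have hm0 : 0 < m := by linarith
  have hsub (Y' : F) (hY' : Y' ∈ frontier Ω) : ⟪Y' - Y, W - Z₀⟫_ℝ ≤ η * f Y' := by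
    rw [hWZ₀]
    refine (hΩ.inner_lift_le hY (hΩ.frontier_subset hY') hτ).trans ?_
    rw [real_inner_smul_right]
    refine mul_le_mul_of_nonneg_left ?_ hη.le
    have := hZ.2 Y' hY'
    linarith
  set m₁ := ⟪Y - X₀, W - Z₀⟫_ℝ with hm₁
  have hm₁m : η * m ≤ m₁ := by
    have h1 := hsub X₀ hX₀
    rw [← neg_sub Y X₀, inner_neg_left] at h1
    linarith
  have hηm : 0 < η * m := mul_pos hη hm0
  have hm₁0 : 0 < m₁ := hηm.trans_le hm₁m
  have hm₁l : m₁ ≤ l₁ * ⟪Y - X₀, v⟫_ℝ := by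
    have h1 := hΩ.inner_unitNormal_le hY (hΩ.frontier_subset hX₀)
    rw [← neg_sub Y X₀, inner_neg_right, real_inner_comm] at h1
    rw [hm₁, hWeq, inner_sub_right, real_inner_smul_right, real_inner_smul_right]
    have := mul_nonneg hκ₁0 (by linarith : 0 ≤ ⟪Y - X₀, N⟫_ℝ)
    linarith
  have hl₁pos : 0 < l₁ := by
    refine hl₁0.lt_of_ne fun h0 => ?_
    rw [← h0, zero_mul] at hm₁l
    linarith
  set t := η * m / (2 * m₁) with ht
  have ht0 : 0 < t := by positivity
  have ht2 : t ≤ 1 / 2 := by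
    rw [ht, div_le_iff₀ (by positivity)]
    linarith
  have htm : t * m₁ = η * m / 2 := by
    rw [ht]
    field_simp
  refine ⟨t • (W - Z₀), t * l₁, t * κ₁, ?_, mul_pos ht0 hl₁pos, mul_nonneg ht0.le hκ₁0, ?_, ?_, ?_,
    ?_, ?_⟩
  · rw [hWeq]
    module
  · have := mul_le_mul_of_nonneg_left hκ₁le ht0.le
    linarith
  · have := mul_le_mul_of_nonneg_left hm₁l ht0.le
    linarith
  · intro Y' hY' hfY'
    have h1 := hsub Y' hY'
    have h2 : Y' - X₀ = (Y' - Y) + (Y - X₀) := by abel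
    rw [real_inner_smul_right, h2, inner_add_left, ← hm₁, ← htm]
    refine mul_le_mul_of_nonneg_left ?_ ht0.le
    nlinarith
  · exact hΩ.convex.add_smul_sub_mem (hΩ.frontier_subset hZ₀) (hΩ.frontier_subset hlift)
      ⟨ht0.le, by linarith⟩
  · rw [norm_smul, Real.norm_of_nonneg ht0.le]
    have := mul_le_mul ht2 hWr (norm_nonneg _) (by norm_num)
    linarith

end SupportDirections

/-! ### Volume of a convex set and its farthest directions -/

section ConvexVolume

variable {T : Type*} [NormedAddCommGroup T] [InnerProductSpace ℝ T] [FiniteDimensional ℝ T]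
  {A : Set T} {x₀ w : T}

/-- In a nontrivial subspace `W` there is a unit vector `e` along the projection to `W` of the point
of `A` for which this projection is farthest from that of `x₀`. -/
theorem exists_farthest_direction (hA : IsCompact A) (hx₀ : x₀ ∈ A) {W : Submodule ℝ T}
    (hW : W ≠ ⊥) :
    ∃ e ∈ W, ‖e‖ = 1 ∧ ∃ y ∈ A, ∃ a : ℝ, 0 ≤ a ∧ (∀ x ∈ A, |⟪x - x₀, e⟫_ℝ| ≤ a) ∧
      ∀ z ∈ W, ⟪y - x₀, z⟫_ℝ = a * ⟪e, z⟫_ℝ := by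
  obtain ⟨y, hy, hmax⟩ := hA.exists_isMaxOn ⟨x₀, hx₀⟩
    (f := fun x => ‖W.starProjection (x - x₀)‖) (by fun_prop)
  have hself (x z : T) (hz : z ∈ W) : ⟪W.starProjection x, z⟫_ℝ = ⟪x, z⟫_ℝ := by
    rw [Submodule.inner_starProjection_left_eq_right, Submodule.starProjection_eq_self_iff.2 hz]
  obtain ⟨e, heW, he1, hey⟩ : ∃ e ∈ W, ‖e‖ = 1 ∧
      W.starProjection (y - x₀) = ‖W.starProjection (y - x₀)‖ • e := by
    by_cases h0 : W.starProjection (y - x₀) = 0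
    · obtain ⟨b, hb, hb0⟩ := Submodule.exists_mem_ne_zero_of_ne_bot hW
      exact ⟨‖b‖⁻¹ • b, W.smul_mem _ hb, norm_smul_inv_norm hb0, by simp [h0]⟩
    · exact ⟨_, W.smul_mem _ (Submodule.starProjection_apply_mem W _), norm_smul_inv_norm h0,
        (smul_inv_smul₀ (norm_ne_zero_iff.2 h0) _).symm⟩
  refine ⟨e, heW, he1, y, hy, ‖W.starProjection (y - x₀)‖, norm_nonneg _, fun x hx => ?_,
    fun z hz => ?_⟩
  · rw [← hself _ _ heW]
    refine (abs_real_inner_le_norm _ _).trans ?_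
    rw [he1, mul_one]
    exact hmax hx
  · rw [← hself _ _ hz, hey, real_inner_smul_left, ← hey]

/-- Starting from `w`, an orthonormal family is chosen by repeatedly taking the farthest direction in
the orthogonal complement of the vectors chosen so far. -/
theorem exists_farthest_orthonormal (hA : IsCompact A) (hx₀ : x₀ ∈ A) (hw : ‖w‖ = 1) (k : ℕ)
    (hk : k < Module.finrank ℝ T) :
    ∃ (v y : ℕ → T) (a : ℕ → ℝ), v 0 = w ∧ (∀ i ≤ k, ‖v i‖ = 1) ∧
      (∀ i j, i < j → j ≤ k → ⟪v i, v j⟫_ℝ = 0) ∧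
      ∀ i, 0 < i → i ≤ k → y i ∈ A ∧ 0 ≤ a i ∧ (∀ x ∈ A, |⟪x - x₀, v i⟫_ℝ| ≤ a i) ∧
        ∀ z, (∀ j < i, ⟪v j, z⟫_ℝ = 0) → ⟪y i - x₀, z⟫_ℝ = a i * ⟪v i, z⟫_ℝ := by
  induction k with
  | zero =>
    refine ⟨fun _ => w, fun _ => x₀, fun _ => 0, rfl, fun _ _ => hw, fun i j hij hj => ?_,
      fun i hi hi' => ?_⟩ <;> omega
  | succ k ih =>
    obtain ⟨v, y, a, hv0, hv1, hvo, hy⟩ := ih (by omega)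
    set W : Submodule ℝ T := (Submodule.span ℝ (range fun i : Fin (k + 1) => v i))ᗮ with hWdef
    have hWmem (z : T) : z ∈ W ↔ ∀ j ≤ k, ⟪v j, z⟫_ℝ = 0 := by
      rw [hWdef, Submodule.mem_orthogonal]
      constructor
      · intro h j hj
        exact h _ (Submodule.subset_span ⟨⟨j, by omega⟩, rfl⟩)
      · intro h u hu
        induction hu using Submodule.span_induction with
        | mem x hx =>
          obtain ⟨i, rfl⟩ := hx
          exact h _ (by omega)
        | zero => exact inner_zero_left _
        | add x y _ _ hx hy => rw [inner_add_left, hx, hy, add_zero]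
        | smul c x _ hx => rw [real_inner_smul_left, hx, mul_zero]
    have hW : W ≠ ⊥ := by
      intro hbot
      rw [hWdef, Submodule.orthogonal_eq_bot_iff] at hbot
      have h1 := finrank_range_le_card (R := ℝ) fun i : Fin (k + 1) => v i
      rw [Set.finrank, hbot, finrank_top, Fintype.card_fin] at h1
      omega
    obtain ⟨e, heW, he1, y', hy', b, hb0, hb, hbz⟩ := exists_farthest_direction hA hx₀ hW
    refine ⟨fun i => if i ≤ k then v i else e, fun i => if i ≤ k then y i else y',
      fun i => if i ≤ k then a i else b, by simpa using hv0, fun i hi => ?_, fun i j hij hj => ?_,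
      fun i hi0 hi => ?_⟩
    · by_cases h : i ≤ k
      · simpa [h] using hv1 i h
      · simpa [h] using he1
    · have hi : i ≤ k := by omega
      by_cases h : j ≤ k
      · simpa [h, hi] using hvo i j hij h
      · simpa [h, hi] using (hWmem e).1 heW i hi
    · by_cases h : i ≤ k
      · obtain ⟨h1, h2, h3, h4⟩ := hy i hi0 h
        simp only [h, if_true]
        refine ⟨h1, h2, h3, fun z hz => h4 z fun j hj => ?_⟩
        simpa [(by omega : j ≤ k)] using hz j hj
      · simp only [h, if_false]
        refine ⟨hy', hb0, hb, fun z hz => hbz z ((hWmem z).2 fun j hj => ?_)⟩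
        simpa [hj] using hz j (by omega)

/-- In suitable orthonormal coordinates starting with `w`, the volume of a compact convex set is at
least a constant times the product of the length of any chord parallel to `w` and of the extents `a i`
of the set from `x₀` in the other directions. The chord and the farthest points in these directions
span a parallelepiped inside the set, and its coordinate matrix is triangular. -/
theorem exists_orthonormal_le_volume (hA : IsCompact A) (hconv : Convex ℝ A) (hx₀ : x₀ ∈ A)
    (hw : ‖w‖ = 1) {k : ℕ} (hk : k < Module.finrank ℝ T) :
    ∃ (v : Fin (k + 1) → T) (a : Fin k → ℝ), Orthonormal ℝ v ∧ v 0 = w ∧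
      (∀ i, ∀ x ∈ A, ⟪x - x₀, v i.succ⟫_ℝ ≤ a i) ∧
      ∀ y₁ ∈ A, ∀ y₂ ∈ A, y₁ - y₂ = ‖y₁ - y₂‖ • w →
        ENNReal.ofReal ((1 / (2 * ((k : ℝ) + 1))) ^ (k + 1) * (‖y₁ - y₂‖ * ∏ i, a i)) ≤
          volume ((fun x i => ⟪x, v i⟫_ℝ) '' A) := by
  obtain ⟨v, y, a, hv0, hv1, hvo, hy⟩ := exists_farthest_orthonormal hA hx₀ hw k hk
  refine ⟨fun i => v i, fun i => a (i + 1), ⟨fun i => hv1 i (by omega), fun i j hij => ?_⟩, hv0,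
    fun i x hx => ?_, ?_⟩
  · rcases lt_or_gt_of_ne hij with h | h
    · exact hvo i j h (by omega)
    · change ⟪v i, v j⟫_ℝ = 0
      rw [real_inner_comm]
      exact hvo j i h (by omega)
  · exact (le_abs_self _).trans ((hy (i + 1) (by omega) (by omega)).2.2.1 x hx)
  intro y₁ hy₁ y₂ hy₂ hchord
  set ℓ := ‖y₁ - y₂‖ with hℓ
  set c : ℝ := 1 / ((k : ℝ) + 1) with hc
  have hc0 : 0 < c := by positivity
  have hck : ((k : ℝ) + 1) * c = 1 := by rw [hc]; field_simp
  let q : Fin (k + 1) → T :=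
    Fin.cons ((1 / 2 : ℝ) • (y₁ - y₂)) fun i => (1 / 2 : ℝ) • (y (i + 1) - x₀)
  have hq0 : q 0 = (1 / 2 : ℝ) • (y₁ - y₂) := rfl
  have hqs (i : Fin k) : q i.succ = (1 / 2 : ℝ) • (y (i + 1) - x₀) := rfl
  let B : Matrix (Fin (k + 1)) (Fin (k + 1)) ℝ := Matrix.of fun j i => ⟪q i, v j⟫_ℝ
  have hB (j i : Fin (k + 1)) : B j i = ⟪q i, v j⟫_ℝ := rfl
  have hB0 (j : Fin (k + 1)) : B j 0 = ℓ / 2 * ⟪v 0, v j⟫_ℝ := by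
    rw [hB, hq0, hchord, real_inner_smul_left, real_inner_smul_left, hv0]
    ring
  have hvself (i : ℕ) (hi : i ≤ k) : ⟪v i, v i⟫_ℝ = 1 := by
    rw [real_inner_self_eq_norm_sq, hv1 i hi, one_pow]
  -- The vector chosen at step `i` is a multiple of `v i` modulo the earlier directions.
  have hBs (j : Fin (k + 1)) (i : Fin k) (hij : i.succ ≤ j) :
      B j i.succ = a (i + 1) / 2 * ⟪v (i + 1), v j⟫_ℝ := by
    have hij' : (i : ℕ) + 1 ≤ j := by simpa [Fin.le_def] using hij
    rw [hB, hqs, real_inner_smul_left, (hy (i + 1) (by omega) (by omega)).2.2.2 (v j)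
      fun j' hj' => hvo j' j (by omega) (by omega)]
    ring
  have htri : B.BlockTriangular id := by
    intro j i hij
    have hij' : (i : ℕ) < j := hij
    induction i using Fin.cases with
    | zero => rw [hB0, hvo 0 j hij' (by omega), mul_zero]
    | succ i =>
      rw [hBs j i hij.le]
      rw [Fin.val_succ] at hij'
      rw [hvo _ _ hij' (by omega), mul_zero]
  have hdet : B.det = ℓ / 2 * ∏ i : Fin k, (a (i + 1) / 2) := by
    rw [Matrix.det_of_isUpperTriangular htri, Fin.prod_univ_succ, hB0]
    have : ⟪v 0, v ((0 : Fin (k + 1)) : ℕ)⟫_ℝ = 1 := hvself 0 (by omega)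
    rw [this, mul_one]
    congr 1
    refine Finset.prod_congr rfl fun i _ => ?_
    rw [hBs _ _ le_rfl, Fin.val_succ, hvself _ (by omega), mul_one]
  let base : Fin (k + 1) → ℝ := fun j => ⟪(1 / 2 : ℝ) • (y₂ + x₀), v j⟫_ℝ
  have hsub : (fun z => base + z) '' (Matrix.toLin' B '' Icc 0 fun _ => c) ⊆
      (fun x (i : Fin (k + 1)) => ⟪x, v i⟫_ℝ) '' A := by
    rintro _ ⟨_, ⟨s, ⟨hs0, hs1⟩, rfl⟩, rfl⟩
    refine ⟨(1 / 2 : ℝ) • (y₂ + s 0 • (y₁ - y₂)) +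
      (1 / 2 : ℝ) • (x₀ + ∑ i : Fin k, s i.succ • (y (i + 1) - x₀)), ?_, ?_⟩
    · have hc1 : c ≤ 1 := by
        have : (0 : ℝ) ≤ k * c := by positivity
        linarith
      refine hconv ?_ ?_ (by norm_num) (by norm_num) (by norm_num)
      · exact hconv.add_smul_sub_mem hy₂ hy₁ ⟨hs0 0, (hs1 0).trans hc1⟩
      · have hsum : ∑ i : Fin k, s i.succ ≤ 1 := by
          calc ∑ i : Fin k, s i.succ ≤ ∑ _i : Fin k, c :=
                Finset.sum_le_sum fun i _ => hs1 i.succ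
            _ = k * c := by simp
            _ ≤ 1 := by linarith
        have hmem := hconv.sum_mem (t := Finset.univ)
          (w := Fin.cons (1 - ∑ i : Fin k, s i.succ) fun i : Fin k => s i.succ)
          (z := Fin.cons x₀ fun i : Fin k => y (i + 1)) ?_ ?_ ?_
        · rw [Fin.sum_univ_succ] at hmem
          simp only [Fin.cons_zero, Fin.cons_succ] at hmem
          convert hmem using 1
          simp only [smul_sub, Finset.sum_sub_distrib, sub_smul, one_smul, Finset.sum_smul]
          abel
        · intro i _
          induction i using Fin.cases with
          | zero => simpa using hsum
          | succ i => simpa using hs0 i.succ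
        · rw [Fin.sum_univ_succ]
          simp
        · intro i _
          induction i using Fin.cases with
          | zero => simpa using hx₀
          | succ i => simpa using (hy (i + 1) (by omega) (by omega)).1
    · funext j
      simp only [Pi.add_apply, Matrix.toLin'_apply, Matrix.mulVec, dotProduct]
      rw [Fin.sum_univ_succ, hB, hq0]
      simp only [hB, hqs, base, inner_add_left, real_inner_smul_left, sum_inner, Finset.mul_sum,
        mul_add]
      have hcomm : ∀ i : Fin k, (1 / 2 : ℝ) * (s i.succ * ⟪y (i + 1) - x₀, v j⟫_ℝ) =
          1 / 2 * ⟪y (i + 1) - x₀, v j⟫_ℝ * s i.succ := fun i => by ring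
      simp only [hcomm]
      ring
  refine le_trans (le_of_eq ?_) (measure_mono hsub)
  rw [image_add_left, measure_preimage_add, Measure.addHaar_image_linearMap, LinearMap.det_toLin',
    hdet, Real.volume_Icc_pi]
  have hprod : 0 ≤ ∏ i : Fin k, (a (i + 1) / 2) := Finset.prod_nonneg fun i _ =>
    div_nonneg (hy (i + 1) (by omega) (by omega)).2.1 zero_le_two
  rw [abs_of_nonneg (mul_nonneg (by positivity) hprod)]
  simp only [Pi.zero_apply, sub_zero, Finset.prod_const, Finset.card_univ, Fintype.card_fin]
  rw [← ENNReal.ofReal_pow hc0.le, ← ENNReal.ofReal_mul (mul_nonneg (by positivity) hprod)]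
  congr 1
  have hc2 : 1 / (2 * ((k : ℝ) + 1)) = c / 2 := by rw [hc]; field_simp
  rw [Finset.prod_div_distrib, Finset.prod_const, Finset.card_univ, Fintype.card_fin, hc2, div_pow]
  field_simp
  ring

end ConvexVolume

/-! ### Measure of the subgradients over a section -/

/-- The parallelepiped spanned by small perturbations of multiples of the coordinate vectors has
volume comparable to that of the corresponding box. -/
theorem le_hausdorffMeasure_parallelepiped {n : ℕ} (hn : 0 < n) {q : Fin n → Fin n → ℝ}
    {l : Fin n → ℝ} (hl : ∀ i, 0 < l i)
    (hq : ∀ i j, |q i j - if i = j then l i else 0| ≤ l i / (2 * n)) :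
    ENNReal.ofReal ((1 / (2 * n)) ^ n * ∏ i, l i) ≤
      μH[(n : ℝ)] ((fun s : Fin n → ℝ => ∑ i, s i • q i) '' Icc 0 fun _ => 1 / (n : ℝ)) := by
  have hn' : (0 : ℝ) < n := Nat.cast_pos.2 hn
  let B : Matrix (Fin n) (Fin n) ℝ := Matrix.of fun j i => q i j / l i
  have hB (x : Fin n → ℝ) (j : Fin n) : Matrix.toLin' B x j = ∑ i, q i j / l i * x i := rfl
  have hbound (x : Fin n → ℝ) : ‖x‖ ≤ (2 : NNReal) * ‖Matrix.toLin' B x‖ := by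
    have h1 : ‖Matrix.toLin' B x - x‖ ≤ ‖x‖ / 2 := by
      refine (pi_norm_le_iff_of_nonneg (by positivity)).2 fun j => ?_
      have h2 : (Matrix.toLin' B x - x) j =
          ∑ i, (q i j - if i = j then l i else 0) / l i * x i := by
        have h3 : x j = ∑ i, (if i = j then l i else 0) / l i * x i := by
          rw [Finset.sum_eq_single j (fun i _ hij => by simp [hij]) (by simp)]
          simp [(hl j).ne']
        rw [Pi.sub_apply, hB]
        conv_lhs => rw [h3]
        rw [← Finset.sum_sub_distrib]
        exact Finset.sum_congr rfl fun i _ => by ring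
      rw [h2]
      calc ‖∑ i, (q i j - if i = j then l i else 0) / l i * x i‖
          ≤ ∑ i : Fin n, 1 / (2 * n) * ‖x‖ := by
            refine norm_sum_le_of_le _ fun i _ => ?_
            rw [norm_mul, norm_div, Real.norm_eq_abs, Real.norm_of_nonneg (hl i).le]
            refine mul_le_mul ?_ (norm_le_pi_norm x i) (norm_nonneg _) (by positivity)
            rw [div_le_iff₀ (hl i)]
            exact (hq i j).trans_eq (by ring)
        _ = ‖x‖ / 2 := by
            rw [Finset.sum_const, Finset.card_univ, Fintype.card_fin, nsmul_eq_mul]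
            field_simp
    have h2 := norm_sub_norm_le x (Matrix.toLin' B x)
    rw [norm_sub_rev] at h2
    change _ ≤ (2 : ℝ) * _
    linarith
  have hanti := AddMonoidHomClass.antilipschitz_of_bound (Matrix.toLin' B) hbound
  have himage : Matrix.toLin' B '' (Icc 0 fun i => l i / n) ⊆
      (fun s : Fin n → ℝ => ∑ i, s i • q i) '' Icc 0 fun _ => 1 / (n : ℝ) := by
    rintro _ ⟨x, ⟨hx0, hx1⟩, rfl⟩
    refine ⟨fun i => x i / l i, ⟨fun i => div_nonneg (hx0 i) (hl i).le, fun i => ?_⟩, ?_⟩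
    · rw [div_le_iff₀ (hl i)]
      exact (hx1 i).trans_eq (by ring)
    · funext j
      rw [hB]
      simp only [Finset.sum_apply, Pi.smul_apply, smul_eq_mul]
      exact Finset.sum_congr rfl fun i _ => by ring
  have hvol : μH[(n : ℝ)] (Icc 0 fun i => l i / n) = ENNReal.ofReal (∏ i, l i / n) := by
    have h1 : (μH[(n : ℝ)] : Measure (Fin n → ℝ)) = volume := by
      have := hausdorffMeasure_pi_real (ι := Fin n)
      rwa [Fintype.card_fin] at this
    rw [h1, Real.volume_Icc_pi]
    simp only [Pi.zero_apply, sub_zero]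
    rw [ENNReal.ofReal_prod_of_nonneg fun i _ => div_nonneg (hl i).le hn'.le]
  have hmain := (hanti.le_hausdorffMeasure_image (Nat.cast_nonneg n) _).trans
    (mul_le_mul_right (measure_mono himage) _)
  rw [hvol, ENNReal.rpow_natCast] at hmain
  have h2 : ENNReal.ofReal ((1 / (2 * n)) ^ n * ∏ i, l i) =
      ENNReal.ofReal ((1 / 2) ^ n) * ENNReal.ofReal (∏ i, l i / n) := by
    rw [← ENNReal.ofReal_mul (by positivity), Finset.prod_div_distrib, Finset.prod_const,
      Finset.card_univ, Fintype.card_fin]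
    congr 1
    have : 1 / (2 * (n : ℝ)) = 1 / 2 / n := by field_simp
    rw [this, div_pow (1 / 2 : ℝ)]
    ring
  have h3 : ENNReal.ofReal ((1 / 2) ^ n) * ((2 : NNReal) : ENNReal) ^ n = 1 := by
    have : ((2 : NNReal) : ENNReal) ^ n = ENNReal.ofReal (2 ^ n) := by
      rw [ENNReal.ofReal_pow zero_le_two]
      simp
    rw [this, ← ENNReal.ofReal_mul (by positivity), ← mul_pow]
    norm_num
  rw [h2]
  refine (mul_le_mul_right hmain _).trans ?_
  rw [← mul_assoc, h3, one_mul]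

section SubgradientMeasure

variable {F : Type*} [NormedAddCommGroup F] [InnerProductSpace ℝ F] [CompleteSpace F]
  [MeasurableSpace F] [BorelSpace F] {Ω : Set F}

/-- Lower bound for the measure of the subgradients at points of the section `{f ≤ 0}`, in terms of
the extents `d i` of the section from `X₀` in orthonormal tangent directions. The dual vectors of
these directions span a simplex; its points, lifted to the boundary along the normal at `X₀`, are
subgradients. The map `x ↦ (⟪x, p j⟫)` below is the oblique projection along that normal, expressed
in the coordinates given by the directions. -/
theorem IsC1Body.le_hausdorffMeasure_linearSubdiff (hΩ : IsC1Body Ω) {r : ℝ}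
    (hr : IsAdmissibleRadius Ω (35 / 36) r) {f : F → ℝ} {Z₀ : F} (hZ₀ : Z₀ ∈ frontier Ω)
    (hne : ∀ X ∈ frontier Ω, (linearSubdiff Ω Z₀ f X).Nonempty)
    (hsmall : ∀ X ∈ frontier Ω, linearSubdiff Ω Z₀ f X ⊆ Metric.ball X (r / 8))
    (hS : ∀ X ∈ frontier Ω, f X ≤ 0 → ‖X - Z₀‖ < r / 8) {n : ℕ} (hn : 0 < n) {ρ η : ℝ}
    (hρ : ∀ X ∈ frontier Ω, ‖X - Z₀‖ < ρ →
      ‖unitNormal Ω Z₀ - unitNormal Ω X‖ ≤ 1 / (18 * n))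
    (hη : 0 < η) (hη1 : η ≤ 1 / 8) (hηρ : 3 * (η * Metric.diam Ω) < ρ)
    {X₀ : F} (hX₀ : X₀ ∈ frontier Ω) (hfX₀ : f X₀ < 0) {v : Fin n → F} (hv : Orthonormal ℝ v)
    (hvZ₀ : ∀ i, ⟪unitNormal Ω Z₀, v i⟫_ℝ = 0) {d : Fin n → ℝ}
    (hd : ∀ i, ∀ Y ∈ frontier Ω, f Y ≤ 0 → ⟪Y - X₀, v i⟫_ℝ ≤ d i) :
    (∀ i, 0 < d i) ∧ ENNReal.ofReal ((η * -f X₀ / (12 * n)) ^ n / ∏ i, d i) ≤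
      μH[(n : ℝ)] (⋃ X ∈ {X ∈ frontier Ω | f X ≤ 0}, linearSubdiff Ω Z₀ f X) := by
  have hn' : (0 : ℝ) < n := Nat.cast_pos.2 hn
  have hn1 : (1 : ℝ) ≤ n := Nat.one_le_cast.2 hn
  have hr0 := hr.1
  have hf := continuousOn_of_linearSubdiff_nonempty hΩ hZ₀ hne
  have hScpt : IsCompact {X ∈ frontier Ω | f X ≤ 0} :=
    hΩ.isCompact_frontier.of_isClosed_subset
      (hf.preimage_isClosed_of_isClosed isClosed_frontier isClosed_Iic) fun X hX => hX.1
  have hmax (i : Fin n) : ∃ Y ∈ frontier Ω, f Y ≤ 0 ∧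
      ∀ Y' ∈ frontier Ω, f Y' ≤ 0 → ⟪Y', v i⟫_ℝ ≤ ⟪Y, v i⟫_ℝ := by
    obtain ⟨Y, hY, hmax⟩ := hScpt.exists_isMaxOn ⟨X₀, hX₀, hfX₀.le⟩
      (f := fun Y => ⟪Y, v i⟫_ℝ) (by fun_prop)
    exact ⟨Y, hY.1, hY.2, fun Y' h1 h2 => hmax (⟨h1, h2⟩ : Y' ∈ {X ∈ frontier Ω | f X ≤ 0})⟩
  choose Y hY hfY hYmax using hmax
  have hε : 1 / (18 * (n : ℝ)) ≤ 1 / 18 := by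
    apply one_div_le_one_div_of_le <;> linarith
  have hdual (i : Fin n) := hΩ.exists_dual_vector hr hZ₀ hne hsmall hε hρ hη (by linarith) hηρ hX₀
    hfX₀ (hY i) (hfY i) (hS _ (hY i) (hfY i)) (hYmax i) (hv.1 i) (hvZ₀ i)
  choose ζ l κ hζ hl hκ0 hκ hld hζS hζΩ hζn using hdual
  set m := -f X₀ with hm
  have hm0 : 0 < m := by linarith
  have hηm : 0 < η * m := mul_pos hη hm0
  have hld' (i : Fin n) : η * m / 2 ≤ l i * d i :=
    (hld i).trans (mul_le_mul_of_nonneg_left (hd i _ (hY i) (hfY i)) (hl i).le)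
  have hd0 (i : Fin n) : 0 < d i := by
    by_contra hcon
    have := mul_nonpos_of_nonneg_of_nonpos (hl i).le (not_lt.1 hcon)
    linarith [hld' i]
  refine ⟨hd0, ?_⟩
  set N₀ := unitNormal Ω Z₀ with hN₀
  set N := unitNormal Ω X₀ with hN
  have hN1 : ‖N‖ = 1 := hΩ.norm_unitNormal hX₀
  have hN₀1 : ‖N₀‖ = 1 := hΩ.norm_unitNormal hZ₀
  have hX₀Z₀ := hS X₀ hX₀ hfX₀.le
  have hang : 35 / 36 < ⟪N₀, N⟫_ℝ :=
    hΩ.lt_inner_unitNormal hr hZ₀ hX₀ (by rw [norm_sub_rev]; linarith)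
  let p : Fin n → F := fun j => v j - (⟪N, v j⟫_ℝ / ⟪N₀, N⟫_ℝ) • N₀
  have hNp (j : Fin n) : ⟪N, p j⟫_ℝ = 0 := by
    simp only [p]
    rw [inner_sub_right, real_inner_smul_right, real_inner_comm N₀ N,
      div_mul_cancel₀ _ (by linarith), sub_self]
  have hvp (i j : Fin n) : ⟪v i, p j⟫_ℝ = if i = j then 1 else 0 := by
    simp only [p]
    rw [inner_sub_right, real_inner_smul_right, real_inner_comm N₀ (v i), hvZ₀, mul_zero, sub_zero]
    exact orthonormal_iff_ite.1 hv i j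
  have hpn (j : Fin n) : ‖p j‖ ≤ 3 := by
    refine (norm_sub_le _ _).trans ?_
    rw [norm_smul, hN₀1, hv.1 j, mul_one, Real.norm_eq_abs, abs_div,
      abs_of_pos (by linarith : 0 < ⟪N₀, N⟫_ℝ)]
    have h1 : |⟪N, v j⟫_ℝ| ≤ 1 := by
      simpa [hN1, hv.1 j] using abs_real_inner_le_norm N (v j)
    have h2 : |⟪N, v j⟫_ℝ| / ⟪N₀, N⟫_ℝ ≤ 2 := by
      rw [div_le_iff₀ (by linarith)]
      linarith
    linarith
  let ψ : F → Fin n → ℝ := fun x j => ⟪x, p j⟫_ℝ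
  have hψlip : LipschitzWith 3 ψ := by
    refine LipschitzWith.of_dist_le_mul fun x y => ?_
    refine (dist_pi_le_iff (by positivity)).2 fun j => ?_
    rw [Real.dist_eq, ← inner_sub_left, dist_eq_norm]
    refine (abs_real_inner_le_norm _ _).trans ?_
    rw [mul_comm]
    exact mul_le_mul_of_nonneg_right (hpn j) (norm_nonneg _)
  set G := ⋃ X ∈ {X ∈ frontier Ω | f X ≤ 0}, linearSubdiff Ω Z₀ f X with hG
  have hsub : (IsometryEquiv.addLeft (ψ Z₀)) ''
      ((fun s : Fin n → ℝ => ∑ i, s i • ψ (ζ i)) '' Icc 0 fun _ => 1 / (n : ℝ)) ⊆ ψ '' G := by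
    rintro _ ⟨_, ⟨s, ⟨hs0, hs1⟩, rfl⟩, rfl⟩
    have hsum : ∑ i, s i ≤ 1 := by
      calc ∑ i, s i ≤ ∑ _i : Fin n, 1 / (n : ℝ) := Finset.sum_le_sum fun i _ => hs1 i
        _ = 1 := by simp [hn'.ne']
    have hMΩ : Z₀ + ∑ i, s i • ζ i ∈ Ω := by
      have h1 : Z₀ + ∑ i, s i • ζ i = ∑ i : Fin n, (1 / (n : ℝ)) • (Z₀ + (n * s i) • ζ i) := by
        simp only [smul_add, Finset.sum_add_distrib, smul_smul, Finset.sum_const,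
          Finset.card_univ, Fintype.card_fin]
        rw [← Nat.cast_smul_eq_nsmul ℝ, smul_smul, mul_one_div_cancel hn'.ne', one_smul]
        congr 1
        refine Finset.sum_congr rfl fun i _ => ?_
        rw [← mul_assoc, one_div_mul_cancel hn'.ne', one_mul]
      rw [h1]
      refine hΩ.convex.sum_mem (fun i _ => by positivity) (by simp [hn'.ne']) fun i _ => ?_
      refine hΩ.convex.add_smul_mem (hΩ.frontier_subset hZ₀) (hζΩ i)
        ⟨mul_nonneg hn'.le (hs0 i), ?_⟩
      have := mul_le_mul_of_nonneg_left (hs1 i) hn'.le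
      rwa [mul_one_div_cancel hn'.ne'] at this
    obtain ⟨τ, hτ, hlift⟩ := hΩ.exists_lift (V := N) hMΩ (norm_pos_iff.1 (hN1 ▸ one_pos))
    have hdist := (hΩ.norm_lift_sub_le hZ₀ hτ hN1 hang.le hlift).2
    rw [add_sub_cancel_left] at hdist
    have hnorm : ‖∑ i, s i • ζ i‖ ≤ 3 / 8 * η * r := by
      calc ‖∑ i, s i • ζ i‖ ≤ ∑ i, s i * (3 / 8 * η * r) := by
            refine norm_sum_le_of_le _ fun i _ => ?_
            rw [norm_smul, Real.norm_of_nonneg (hs0 i)]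
            exact mul_le_mul_of_nonneg_left (hζn i) (hs0 i)
        _ = (∑ i, s i) * (3 / 8 * η * r) := by rw [Finset.sum_mul]
        _ ≤ 1 * (3 / 8 * η * r) := mul_le_mul_of_nonneg_right hsum (by positivity)
        _ = _ := one_mul _
    obtain ⟨X, hX, hfX, hZX⟩ := hΩ.exists_mem_linearSubdiff_of_lt hr hZ₀ hne hsmall hX₀ hfX₀.le
      hlift (by
        have h1 := norm_sub_le_norm_sub_add_norm_sub X₀ Z₀ (Z₀ + ∑ i, s i • ζ i + τ • N)
        rw [norm_sub_rev Z₀] at h1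
        nlinarith) (by
        intro Y' hY' hfY'
        have h1 : Z₀ + ∑ i, s i • ζ i + τ • N - Z₀ = ∑ i, s i • ζ i + τ • N := by abel
        rw [h1]
        refine (hΩ.inner_lift_le hX₀ (hΩ.frontier_subset hY') hτ).trans_lt ?_
        rw [inner_sum]
        calc ∑ i, ⟪Y' - X₀, s i • ζ i⟫_ℝ ≤ ∑ i, s i * (η * m / 2) := by
              refine Finset.sum_le_sum fun i _ => ?_
              rw [real_inner_smul_right]
              exact mul_le_mul_of_nonneg_left (hζS i Y' hY' hfY') (hs0 i)
          _ = (∑ i, s i) * (η * m / 2) := by rw [Finset.sum_mul]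
          _ ≤ 1 * (η * m / 2) := mul_le_mul_of_nonneg_right hsum (by positivity)
          _ < m := by nlinarith)
    refine ⟨_, mem_biUnion (⟨hX, hfX⟩ : X ∈ {X ∈ frontier Ω | f X ≤ 0}) hZX, ?_⟩
    funext j
    simp only [ψ, IsometryEquiv.addLeft_apply, Pi.add_apply, Finset.sum_apply, Pi.smul_apply,
      smul_eq_mul, inner_add_left, sum_inner, real_inner_smul_left, hNp, mul_zero, add_zero]
  have hq (i j : Fin n) : |ψ (ζ i) j - if i = j then l i else 0| ≤ l i / (2 * n) := by
    have h1 : ψ (ζ i) j - (if i = j then l i else 0) = -(κ i * ⟪unitNormal Ω (Y i), p j⟫_ℝ) := by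
      simp only [ψ]
      rw [hζ i, inner_sub_left, real_inner_smul_left, real_inner_smul_left, hvp]
      split_ifs <;> ring
    have h2 : |⟪unitNormal Ω (Y i), p j⟫_ℝ| ≤ 3 := by
      refine (abs_real_inner_le_norm _ _).trans ?_
      rw [hΩ.norm_unitNormal (hY i), one_mul]
      exact hpn j
    rw [h1, abs_neg, abs_mul, abs_of_nonneg (hκ0 i)]
    calc κ i * |⟪unitNormal Ω (Y i), p j⟫_ℝ| ≤ 3 * (1 / (18 * n)) * l i * 3 :=
          mul_le_mul (hκ i) h2 (abs_nonneg _) ((hκ0 i).trans (hκ i))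
      _ = l i / (2 * n) := by field_simp; ring
  have hlow := le_hausdorffMeasure_parallelepiped hn hl hq
  rw [← (IsometryEquiv.addLeft (ψ Z₀)).hausdorffMeasure_image] at hlow
  have hup := (hlow.trans (measure_mono hsub)).trans
    (hψlip.hausdorffMeasure_image_le (Nat.cast_nonneg n) G)
  rw [ENNReal.rpow_natCast] at hup
  have h3 : ENNReal.ofReal ((1 / 3) ^ n) * ((3 : NNReal) : ENNReal) ^ n = 1 := by
    have : ((3 : NNReal) : ENNReal) ^ n = ENNReal.ofReal (3 ^ n) := by
      rw [ENNReal.ofReal_pow (by norm_num)]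
      simp
    rw [this, ← ENNReal.ofReal_mul (by positivity), ← mul_pow]
    norm_num
  have hfin := mul_le_mul_right hup (ENNReal.ofReal ((1 / 3) ^ n))
  rw [← mul_assoc _ _ (μH[(n : ℝ)] G), h3, one_mul, ← ENNReal.ofReal_mul (by positivity)] at hfin
  refine (ENNReal.ofReal_le_ofReal ?_).trans hfin
  have hprod : (η * m / 2) ^ n / ∏ i, d i ≤ ∏ i, l i := by
    rw [div_le_iff₀ (Finset.prod_pos fun i _ => hd0 i), ← Finset.prod_mul_distrib]
    calc (η * m / 2) ^ n = ∏ _i : Fin n, (η * m / 2) := by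
          rw [Finset.prod_const, Finset.card_univ, Fintype.card_fin]
      _ ≤ ∏ i, l i * d i := Finset.prod_le_prod (fun _ _ => by positivity) fun i _ => hld' i
  calc (η * m / (12 * n)) ^ n / ∏ i, d i
      = (1 / 3) ^ n * ((1 / (2 * n)) ^ n * ((η * m / 2) ^ n / ∏ i, d i)) := by
        have : η * m / (12 * n) = 1 / 3 * (1 / (2 * n) * (η * m / 2)) := by field_simp; norm_num
        rw [this, mul_pow (1 / 3), mul_pow (1 / (2 * (n : ℝ))), mul_div_assoc, mul_div_assoc]
    _ ≤ _ := by gcongr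

end SubgradientMeasure

/-! ### Projected sections and the estimate -/

section ProjectedSections

variable {F : Type*} [NormedAddCommGroup F] [InnerProductSpace ℝ F] {Ω : Set F}

theorem inner_unitNormal_tangentSpace {Z : F} (v : tangentSpace Ω Z) :
    ⟪unitNormal Ω Z, (v : F)⟫_ℝ = 0 :=
  Submodule.mem_orthogonal_singleton_iff_inner_right.1 v.2

theorem inner_bracket (Z X : F) (v : tangentSpace Ω Z) :
    ⟪bracket Ω Z X, v⟫_ℝ = ⟪X - Z, (v : F)⟫_ℝ :=
  Submodule.inner_orthogonalProjectionOnto_eq_of_mem_right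
    (K := (ℝ ∙ unitNormal Ω Z)ᗮ) v (X - Z)

theorem lipschitzWith_bracket (Z : F) : LipschitzWith 1 (bracket Ω Z) := by
  refine LipschitzWith.of_dist_le_mul fun X Y => ?_
  rw [dist_eq_norm, dist_eq_norm, NNReal.coe_one, one_mul]
  have h : bracket Ω Z X - bracket Ω Z Y = bracket Ω Z (Z + (X - Y)) := by
    refine ext_inner_right ℝ fun v => ?_
    rw [inner_sub_left, inner_bracket, inner_bracket, inner_bracket, ← inner_sub_left]
    congr 1
    abel
  rw [h, bracket, add_sub_cancel_left]
  exact Submodule.norm_orthogonalProjectionOnto_apply_le _ _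

/-- The supporting hyperplane with normal `w` lies at the distance `max ⟪·, w⟫ - ⟪x, w⟫` from a
point `x`. -/
theorem infDist_supportingHyperplane {A : Set F} {w a x : F} (hw : ‖w‖ = 1) (ha : a ∈ A)
    (hmax : ∀ b ∈ A, ⟪b, w⟫_ℝ ≤ ⟪a, w⟫_ℝ) (hx : x ∈ A) :
    Metric.infDist x (supportingHyperplane A w) = ⟪a - x, w⟫_ℝ := by
  have hww : ⟪w, w⟫_ℝ = 1 := by rw [real_inner_self_eq_norm_sq, hw, one_pow]
  refine le_antisymm ?_ ?_
  · have hmem : x + ⟪a - x, w⟫_ℝ • w ∈ supportingHyperplane A w := by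
      refine ⟨a, ha, hmax, ?_⟩
      rw [inner_add_left, real_inner_smul_left, hww, inner_sub_left]
      ring
    refine (Metric.infDist_le_dist_of_mem hmem).trans_eq ?_
    rw [dist_eq_norm, sub_add_cancel_left, norm_neg, norm_smul, hw, mul_one, Real.norm_eq_abs,
      abs_of_nonneg]
    rw [inner_sub_left]
    linarith [hmax x hx]
  · refine (Metric.le_infDist (s := supportingHyperplane A w) ⟨a, a, ha, hmax, rfl⟩).2 ?_
    rintro y ⟨b, hb, hbmax, hy⟩
    have h1 : ⟪b, w⟫_ℝ = ⟪a, w⟫_ℝ := le_antisymm (hmax b hb) (hbmax a ha)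
    rw [inner_sub_left, ← h1, ← hy, ← inner_sub_left, dist_comm, dist_eq_norm]
    refine (real_inner_le_norm _ _).trans_eq ?_
    rw [hw, mul_one]

variable [CompleteSpace F]

/-- The section `{f ≤ 0}` is convex in the coordinates on the tangent space at `Z₀`. -/
theorem IsC1Body.convex_bracket_image (hΩ : IsC1Body Ω) {f : F → ℝ} {Z₀ : F}
    (hZ₀ : Z₀ ∈ frontier Ω) (hne : ∀ X ∈ frontier Ω, (linearSubdiff Ω Z₀ f X).Nonempty) :
    Convex ℝ (bracket Ω Z₀ '' {X ∈ frontier Ω | f X ≤ 0}) := by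
  rintro _ ⟨X₁, ⟨h₁, hf₁⟩, rfl⟩ _ ⟨X₂, ⟨h₂, hf₂⟩, rfl⟩ a b ha hb hab
  obtain ⟨τ, hτ, hlift⟩ := hΩ.exists_lift (V := unitNormal Ω Z₀) (hΩ.convex
    (hΩ.frontier_subset h₁) (hΩ.frontier_subset h₂) ha hb hab)
    (norm_pos_iff.1 (hΩ.norm_unitNormal hZ₀ ▸ one_pos))
  refine ⟨_, ⟨hlift, ?_⟩, ?_⟩
  · have h := hΩ.le_convex_combination hne hZ₀ h₁ h₂ ha hb hab hτ hlift
    simp only [sub_self, inner_zero_right, sub_zero] at h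
    have h1 := mul_nonpos_of_nonneg_of_nonpos ha hf₁
    have h2 := mul_nonpos_of_nonneg_of_nonpos hb hf₂
    linarith
  · refine ext_inner_right ℝ fun v => ?_
    rw [inner_add_left, real_inner_smul_left, real_inner_smul_left, inner_bracket, inner_bracket,
      inner_bracket, ← real_inner_smul_left, ← real_inner_smul_left, ← inner_add_left]
    have : a • X₁ + b • X₂ + τ • unitNormal Ω Z₀ - Z₀ =
        (a • (X₁ - Z₀) + b • (X₂ - Z₀)) + τ • unitNormal Ω Z₀ := by
      have h0 : a • X₁ + b • X₂ + τ • unitNormal Ω Z₀ - Z₀ = (a • (X₁ - Z₀) + b • (X₂ - Z₀)) +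
          τ • unitNormal Ω Z₀ + (a + b - 1) • Z₀ := by module
      rw [h0, hab, sub_self, zero_smul, add_zero]
    rw [this, inner_add_left _ (τ • _), real_inner_smul_left, inner_unitNormal_tangentSpace,
      mul_zero, add_zero]

/-- The localized estimate with an explicit constant, for the function `f = u - m₀`. -/
theorem IsC1Body.aleksandrov_upper [FiniteDimensional ℝ F] [MeasurableSpace F] [BorelSpace F]
    (hΩ : IsC1Body Ω) {r : ℝ}
    (hr : IsAdmissibleRadius Ω (35 / 36) r) {f : F → ℝ} {Z₀ : F} (hZ₀ : Z₀ ∈ frontier Ω)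
    (hne : ∀ X ∈ frontier Ω, (linearSubdiff Ω Z₀ f X).Nonempty)
    (hsmall : ∀ X ∈ frontier Ω, linearSubdiff Ω Z₀ f X ⊆ Metric.ball X (r / 8))
    (hS : ∀ X ∈ frontier Ω, f X ≤ 0 → ‖X - Z₀‖ < r / 8) {k : ℕ}
    (hk : k < Module.finrank ℝ (tangentSpace Ω Z₀)) {ρ η : ℝ}
    (hρ : ∀ X ∈ frontier Ω, ‖X - Z₀‖ < ρ →
      ‖unitNormal Ω Z₀ - unitNormal Ω X‖ ≤ 1 / (18 * ((k + 1 : ℕ) : ℝ)))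
    (hη : 0 < η) (hη1 : η ≤ 1 / 8) (hηρ : 3 * (η * Metric.diam Ω) < ρ)
    {w : tangentSpace Ω Z₀} (hw : ‖w‖ = 1) {X₀ : F} (hX₀ : X₀ ∈ frontier Ω) (hfX₀ : f X₀ < 0)
    {A : Set (tangentSpace Ω Z₀)} (hA : A = bracket Ω Z₀ '' {X ∈ frontier Ω | f X ≤ 0}) :
    0 < Metric.infDist (bracket Ω Z₀ X₀) (supportingHyperplane A w) ∧
      ENNReal.ofReal (maxSegmentLength A w /
          Metric.infDist (bracket Ω Z₀ X₀) (supportingHyperplane A w) * (-f X₀) ^ (k + 1)) ≤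
        ENNReal.ofReal ((24 * ((k + 1 : ℕ) : ℝ) ^ 2 / η) ^ (k + 1)) *
          μH[((k + 1 : ℕ) : ℝ)] (⋃ X ∈ {X ∈ frontier Ω | f X ≤ 0}, linearSubdiff Ω Z₀ f X) *
          μH[((k + 1 : ℕ) : ℝ)] {X ∈ frontier Ω | f X ≤ 0} := by
  have hf := continuousOn_of_linearSubdiff_nonempty hΩ hZ₀ hne
  have hScpt : IsCompact {X ∈ frontier Ω | f X ≤ 0} :=
    hΩ.isCompact_frontier.of_isClosed_subset
      (hf.preimage_isClosed_of_isClosed isClosed_frontier isClosed_Iic) fun X hX => hX.1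
  have hAcpt : IsCompact A := hA ▸ hScpt.image (lipschitzWith_bracket Z₀).continuous
  have hAconv : Convex ℝ A := hA ▸ hΩ.convex_bracket_image hZ₀ hne
  have hmem {X : F} (hX : X ∈ frontier Ω) (hfX : f X ≤ 0) : bracket Ω Z₀ X ∈ A :=
    hA ▸ mem_image_of_mem _ ⟨hX, hfX⟩
  have hx₀ := hmem hX₀ hfX₀.le
  obtain ⟨y, hy, hymax⟩ := hAcpt.exists_isMaxOn ⟨_, hx₀⟩ (f := fun y => ⟪y, w⟫_ℝ) (by fun_prop)
  rw [infDist_supportingHyperplane hw hy hymax hx₀]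
  obtain ⟨v, a, hv, hv0, ha, hvol⟩ := exists_orthonormal_le_volume hAcpt hAconv hx₀ hw hk
  set d := ⟪y - bracket Ω Z₀ X₀, w⟫_ℝ with hd
  have hbr (Y X : F) (z : tangentSpace Ω Z₀) :
      ⟪Y - X, (z : F)⟫_ℝ = ⟪bracket Ω Z₀ Y - bracket Ω Z₀ X, z⟫_ℝ := by
    rw [inner_sub_left (bracket Ω Z₀ Y), inner_bracket, inner_bracket, ← inner_sub_left,
      sub_sub_sub_cancel_right]
  obtain ⟨hdpos, hsubd⟩ := hΩ.le_hausdorffMeasure_linearSubdiff hr hZ₀ hne hsmall hS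
    (Nat.succ_pos k) hρ hη hη1 hηρ hX₀ hfX₀
    (v := fun i => (v i : F)) (hv.comp_linearIsometry (tangentSpace Ω Z₀).subtypeₗᵢ)
    (fun i => inner_unitNormal_tangentSpace (v i)) (d := Fin.cons d a) (by
      intro i Y hY hfY
      rw [hbr]
      induction i using Fin.cases with
      | zero =>
        have h1 : ⟪bracket Ω Z₀ Y, w⟫_ℝ ≤ ⟪y, w⟫_ℝ := hymax (hmem hY hfY)
        rw [hv0, Fin.cons_zero, hd, inner_sub_left, inner_sub_left]
        linarith
      | succ i => exact ha i _ (hmem hY hfY))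
  have hd0 : 0 < d := hdpos 0
  have hapos (i : Fin k) : 0 < a i := hdpos i.succ
  refine ⟨hd0, ?_⟩
  rw [Fin.prod_univ_succ] at hsubd
  simp only [Fin.cons_zero, Fin.cons_succ] at hsubd
  -- The coordinates of the projected section are `1`-Lipschitz functions of the section.
  have hSvol : volume ((fun x i => ⟪x, v i⟫_ℝ) '' A) ≤
      μH[((k + 1 : ℕ) : ℝ)] {X ∈ frontier Ω | f X ≤ 0} := by
    have h1 : (μH[((k + 1 : ℕ) : ℝ)] : Measure (Fin (k + 1) → ℝ)) = volume := by
      have := hausdorffMeasure_pi_real (ι := Fin (k + 1))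
      rwa [Fintype.card_fin] at this
    have h2 : LipschitzWith 1 fun (x : tangentSpace Ω Z₀) (i : Fin (k + 1)) => ⟪x, v i⟫_ℝ := by
      refine LipschitzWith.of_dist_le_mul fun x y => ?_
      refine (dist_pi_le_iff (by positivity)).2 fun j => ?_
      rw [Real.dist_eq, ← inner_sub_left, dist_eq_norm, NNReal.coe_one, one_mul]
      refine (abs_real_inner_le_norm _ _).trans_eq ?_
      rw [hv.1, mul_one]
    have h3 := (h2.comp (lipschitzWith_bracket Z₀)).hausdorffMeasure_image_le
      (Nat.cast_nonneg (k + 1)) {X ∈ frontier Ω | f X ≤ 0}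
    rw [image_comp, ← hA, h1] at h3
    simpa using h3
  set m := -f X₀ with hm
  have hm0 : 0 < m := by linarith
  have hprod : 0 < ∏ i, a i := Finset.prod_pos fun i _ => hapos i
  set μ₁ := μH[((k + 1 : ℕ) : ℝ)] (⋃ X ∈ {X ∈ frontier Ω | f X ≤ 0}, linearSubdiff Ω Z₀ f X)
  set μ₂ := μH[((k + 1 : ℕ) : ℝ)] {X ∈ frontier Ω | f X ≤ 0}
  set C := (24 * ((k + 1 : ℕ) : ℝ) ^ 2 / η) ^ (k + 1) with hC
  have hn0 : (0 : ℝ) < ((k + 1 : ℕ) : ℝ) := Nat.cast_pos.2 (Nat.succ_pos k)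
  have hchord : ∀ t ∈ {t : ℝ | ∃ y₁ ∈ A, ∃ y₂ ∈ A, y₁ - y₂ = ‖y₁ - y₂‖ • w ∧ t = ‖y₁ - y₂‖},
      ENNReal.ofReal (t / d * m ^ (k + 1)) ≤ ENNReal.ofReal C * μ₁ * μ₂ := by
    rintro _ ⟨y₁, hy₁, y₂, hy₂, hchord, rfl⟩
    have h1 := (hvol y₁ hy₁ y₂ hy₂ hchord).trans hSvol
    refine le_trans (le_of_eq ?_) (mul_le_mul' (mul_le_mul_right hsubd (ENNReal.ofReal C)) h1)
    rw [← ENNReal.ofReal_mul (by positivity), ← ENNReal.ofReal_mul (by positivity)]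
    congr 1
    have h2 : C * (η * m / (12 * ((k + 1 : ℕ) : ℝ))) ^ (k + 1) *
        (1 / (2 * ((k : ℝ) + 1))) ^ (k + 1) = m ^ (k + 1) := by
      rw [hC, ← mul_pow, ← mul_pow]
      congr 1
      rw [Nat.cast_succ] at hn0 ⊢
      field_simp
      norm_num
    rw [← h2]
    field_simp
  by_cases htop : ENNReal.ofReal C * μ₁ * μ₂ = ⊤
  · rw [htop]
    exact le_top
  · have h1 : maxSegmentLength A w ≤
        (ENNReal.ofReal C * μ₁ * μ₂).toReal * d / m ^ (k + 1) := by
      refine Real.sSup_le (fun t ht => ?_) (by positivity)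
      have h2 := (ENNReal.ofReal_le_iff_le_toReal htop).1 (hchord t ht)
      rw [le_div_iff₀ (by positivity)]
      rw [div_mul_eq_mul_div, div_le_iff₀ hd0] at h2
      exact h2
    rw [ENNReal.ofReal_le_iff_le_toReal htop, div_mul_eq_mul_div, div_le_iff₀ hd0]
    rwa [le_div_iff₀ (by positivity)] at h1

end ProjectedSections

end BoundaryTransport

theorem theorem4p3 (n : ℕ) (Ω : Set (EuclideanSpace ℝ (Fin (n + 1))))
    (hcompact : IsCompact Ω) (hconvex : Convex ℝ Ω) (hzero : 0 ∈ interior Ω)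
    (hC1 : BoundaryTransport.HasC1Boundary Ω) :
    ∃ C : ℝ, 0 < C ∧
      ∀ R : ℝ, Ω ⊆ Metric.ball 0 R →
      ∀ r : ℝ, BoundaryTransport.IsAdmissibleRadius Ω (35 / 36) r →
      ∀ u : EuclideanSpace ℝ (Fin (n + 1)) → ℝ, BoundaryTransport.IsCConvex R u →
      (∀ X ∈ frontier Ω, (BoundaryTransport.cSubdiff Ω u X).Nonempty) →
      (∀ X ∈ frontier Ω, BoundaryTransport.cSubdiff Ω u X ⊆ Metric.ball X (r / 8)) →
      ∀ Z₀ ∈ frontier Ω, ∀ h : ℝ, 0 < h →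
      BoundaryTransport.cSection Ω u Z₀ h ⊆ Metric.ball Z₀ (r / 8) →
      ∀ w : BoundaryTransport.tangentSpace Ω Z₀, ‖w‖ = 1 →
      ∀ X₀ ∈ BoundaryTransport.cSection Ω u Z₀ h, u X₀ < BoundaryTransport.mZero Z₀ h X₀ →
        0 < Metric.infDist (BoundaryTransport.bracket Ω Z₀ X₀)
            (BoundaryTransport.supportingHyperplane (BoundaryTransport.projSection Ω u Z₀ h) w) ∧
        ENNReal.ofReal
            (BoundaryTransport.maxSegmentLength (BoundaryTransport.projSection Ω u Z₀ h) w /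
              Metric.infDist (BoundaryTransport.bracket Ω Z₀ X₀)
                (BoundaryTransport.supportingHyperplane
                  (BoundaryTransport.projSection Ω u Z₀ h) w) *
              (BoundaryTransport.mZero Z₀ h X₀ - u X₀) ^ n) ≤
          ENNReal.ofReal C *
            μH[(n : ℝ)] (BoundaryTransport.cSubdiffImage Ω u (BoundaryTransport.cSection Ω u Z₀ h)) *
            μH[(n : ℝ)] (BoundaryTransport.cSection Ω u Z₀ h) := by
  have hΩ : BoundaryTransport.IsC1Body Ω := ⟨hcompact, hconvex, hC1⟩
  have hrank (Z₀ : EuclideanSpace ℝ (Fin (n + 1))) (hZ₀ : Z₀ ∈ frontier Ω) :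
      Module.finrank ℝ (BoundaryTransport.tangentSpace Ω Z₀) = n := by
    have : Fact (Module.finrank ℝ (EuclideanSpace ℝ (Fin (n + 1))) = n + 1) :=
      ⟨by simp⟩
    exact Submodule.finrank_orthogonal_span_singleton
      (norm_pos_iff.1 (hΩ.norm_unitNormal hZ₀ ▸ one_pos))
  cases n with
  | zero =>
    -- In dimension one the tangent space is trivial and has no unit vector.
    refine ⟨1, one_pos, fun R _ r _ u _ _ _ Z₀ hZ₀ h _ _ w hw => ?_⟩
    have := Module.finrank_zero_iff.1 (hrank Z₀ hZ₀)
    rw [Subsingleton.elim w 0, norm_zero] at hw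
    exact absurd hw zero_ne_one
  | succ k =>
    obtain ⟨ρ, hρ0, hρ⟩ := hΩ.exists_norm_unitNormal_sub_le
      (by positivity : (0 : ℝ) < 1 / (18 * ((k + 1 : ℕ) : ℝ)))
    have hdiam : 0 ≤ Metric.diam Ω := Metric.diam_nonneg
    -- The contraction factor brings any two boundary points to a distance less than `ρ / 3`.
    set η : ℝ := min (1 / 8) (ρ / (4 * (Metric.diam Ω + 1))) with hη
    have hη0 : 0 < η := by positivity
    have hηρ : 3 * (η * Metric.diam Ω) < ρ := by
      have h1 : η * (4 * (Metric.diam Ω + 1)) ≤ ρ :=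
        (le_div_iff₀ (by positivity)).1 (min_le_right _ _)
      nlinarith
    refine ⟨(24 * ((k + 1 : ℕ) : ℝ) ^ 2 / η) ^ (k + 1), by positivity,
      fun R _ r hr u _ hne hsmall Z₀ hZ₀ h _ hS w hw X₀ hX₀ hlt => ?_⟩
    have hsec : BoundaryTransport.cSection Ω u Z₀ h =
        {X ∈ frontier Ω | u X - BoundaryTransport.mZero Z₀ h X ≤ 0} := by
      ext X
      simp [BoundaryTransport.cSection]
    simp only [BoundaryTransport.cSubdiff_eq_linearSubdiff u Z₀ h] at hne hsmall
    have hmain := hΩ.aleksandrov_upper (k := k) hr hZ₀ hne hsmall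
      (fun X hX hfX => by
        rw [← dist_eq_norm]
        exact hS (hsec ▸ ⟨hX, hfX⟩))
      (by rw [hrank Z₀ hZ₀]; exact Nat.lt_succ_self k)
      (fun X hX hXZ₀ => hρ Z₀ hZ₀ X hX (by rwa [norm_sub_rev]))
      hη0 (min_le_left _ _) hηρ hw hX₀.1 (sub_neg.2 hlt) rfl
    simp only [← hsec, ← BoundaryTransport.cSubdiff_eq_linearSubdiff u Z₀ h, neg_sub] at hmain
    exact hmain
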